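/- Let $\mathfrak H$ be a complex Hilbert space, and let $A$ be a densely defined closed symmetric operator in $\mathfrak H$ with deficiency indices $(1,1)$. Let $\{\mathbb C,\Gamma_0,\Gamma_1\}$ be a boundary triplet for $A^*$, i.e. $\Gamma_0,\Gamma_1\colon\mathfrak D(A^*)\to\mathbb C$ are linear maps such that $$\langle A^*x,y\rangle-\langle x,A^*y\rangle=\Gamma_1x\,\overline{\Gamma_0y}-\Gamma_0x\,\overline{\Gamma_1y}\qquad(x,y\in\mathfrak D(A^*))$$ and $x\mapsto(\Gamma_0x,\Gamma_1x)$ maps $\mathfrak D(A^*)$ onto $\mathbb C^2$. Let $f$ be a Herglotz–Nevanlinna function, i.e. $f$ is holomorphic on the open upper half-plane $\mathbb C_+$ with $\operatorname{Im}f\ge0$ there; put $f(\lambda):=\overline{f(\overline\lambda)}$ for $\operatorname{Im}\lambda<0$. Then $f$ admits a representation $$f(\lambda)=h_0\lambda+h+\int_{-\infty}^{\infty}\Big(\frac1{t-\lambda}-\frac t{1+t^2}\Big)\,d\sigma(t),\qquad \lambda\in\mathbb C_+,$$ with $h_0\ge0$, $h\in\mathbb R$ and a Borel measure $\sigma$ on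 $\mathbb R$ with $\int\frac{d\sigma(t)}{1+t^2}<\infty$. For any such representation define a Hilbert space $\widetilde{\mathfrak H}\supset\mathfrak H$ and an operator $\widetilde A$ in it as follows. If $h_0>0$, let $\widetilde{\mathfrak H}=\mathfrak H\oplus L^2(\mathbb R;d\sigma)\oplus\mathbb C$ with inner product $\langle x_0,y_0\rangle+\int x_1\overline{y_1}\,d\sigma+x_2\overline{y_2}/h_0$, let $\mathfrak D(\widetilde A)$ be the set of all $(x_0,x_1,x_2)\in\widetilde{\mathfrak H}$ with $x_0\in\mathfrak D(A^*)$, $t\,x_1(t)-\Gamma_0x_0\in L^2(\mathbb R;d\sigma)$ and $x_2=-h_0\Gamma_0x_0$, and let $$\widetilde A(x_0,x_1,x_2)=\Big(A^*x_0,\ t\,x_1(t)-\Gamma_0x_0,\ \Gamma_1x_0+h\Gamma_0x_0+\int_{-\infty}^{\infty}\Big(x_1(t)-\frac t{1+t^2}\Gamma_0x_0\Big)d\sigma(t)\Big).$$ If $h_0=0$, let $\widetilde{\mathfrak H}=\mathfrak H\oplus L^2(\mathbb R;d\sigma)$, let $\mathfrak D(\widetilde A)$ be the set of all $(x_0,x_1)\in\widetilde{\mathfrak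 H}$ with $x_0\in\mathfrak D(A^*)$, $t\,x_1(t)-\Gamma_0x_0\in L^2(\mathbb R;d\sigma)$ and $$\Gamma_1x_0+h\Gamma_0x_0+\int_{-\infty}^{\infty}\Big(x_1(t)-\frac t{1+t^2}\Gamma_0x_0\Big)d\sigma(t)=0,$$ and let $\widetilde A(x_0,x_1)=(A^*x_0,\ t\,x_1(t)-\Gamma_0x_0)$. Then: 1. $\widetilde A$ is a (densely defined) self-adjoint operator in $\widetilde{\mathfrak H}$ and $A\subset\widetilde A$. 2. $\widetilde A$ is a minimal extension of $A$: no nonzero closed subspace of $\widetilde{\mathfrak H}\ominus\mathfrak H$ reduces $\widetilde A$; equivalently, the linear span of all $(\widetilde A-\lambda I)^{-1}x$ with $x\in\mathfrak H$ and $\lambda\in\mathbb C\setminus\mathbb R$ is dense in $\widetilde{\mathfrak H}$. 3. Every $\lambda\in\mathbb C\setminus\mathbb R$ belongs to the resolvent set of $\widetilde A$, and the compressed resolvent $R(\lambda)=P_{\mathfrak H}(\widetilde A-\lambda I)^{-1}|_{\mathfrak H}$ is the generalized resolvent $R_f(\lambda)$: it is holomorphic on $\mathbb C\setminus\mathbb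 R$, and for all $\lambda\in\mathbb C\setminus\mathbb R$ and $x\in\mathfrak H$ the vector $y=R(\lambda)x$ is the unique $y\in\mathfrak D(A^*)$ with $A^*y-\lambda y=x$ and $\Gamma_1y+f(\lambda)\Gamma_0y=0$. -/

import Mathlib

open MeasureTheory
open scoped ComplexConjugate LinearPMap ENNReal

noncomputable section

/-! ### Unbounded operators: resolvents, deficiency indices, self-adjoint extensions -/

section Operators

variable {H : Type*} [NormedAddCommGroup H] [InnerProductSpace ℂ H] [CompleteSpace H]
variable {K : Type*} [NormedAddCommGroup K] [InnerProductSpace ℂ K] [CompleteSpace K]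

/-- `A` is symmetric: `⟪A x, y⟫ = ⟪x, A y⟫` on the domain of `A`. -/
def IsSymmetricOp (A : H →ₗ.[ℂ] H) : Prop := A.IsFormalAdjoint A

/-- The eigenspace `ker (A† - z)`. -/
def deficiencySpace (A : H →ₗ.[ℂ] H) (z : ℂ) : Submodule ℂ H :=
  (LinearMap.ker (A†.toFun - z • A†.domain.subtype)).map A†.domain.subtype

/-- `A` has (finite) deficiency indices `(m, n)`:
`dim ker (A† - i) = m` and `dim ker (A† + i) = n`. -/
def HasDeficiencyIndices (A : H →ₗ.[ℂ] H) (m n : ℕ) : Prop :=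
  Module.rank ℂ (deficiencySpace A Complex.I) = m ∧
    Module.rank ℂ (deficiencySpace A (-Complex.I)) = n

/-- A boundary triplet `{ℂ, Γ₀, Γ₁}` for `A†`. Mathlib's inner product is conjugate-linear in the
first variable, so `inner ℂ y x` is the `⟨x, y⟩` that is linear in `x`. -/
structure BoundaryTriplet (A : H →ₗ.[ℂ] H) where
  Γ₀ : A†.domain →ₗ[ℂ] ℂ
  Γ₁ : A†.domain →ₗ[ℂ] ℂ
  green : ∀ x y : A†.domain,
    inner ℂ (y : H) (A† x) - inner ℂ (A† y) (x : H) = Γ₁ x * conj (Γ₀ y) - Γ₀ x * conj (Γ₁ y)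
  surjective : Function.Surjective fun x : A†.domain => (Γ₀ x, Γ₁ x)

/-- The bounded operator `R` is the inverse `(T - z)⁻¹` of `T - z : D(T) → K`. -/
def IsResolventAt (T : K →ₗ.[ℂ] K) (z : ℂ) (R : K →L[ℂ] K) : Prop :=
  (∀ x : K, ∃ h : R x ∈ T.domain, T ⟨R x, h⟩ - z • R x = x) ∧
    ∀ y : T.domain, R (T y - z • (y : K)) = y

open Classical in
/-- The resolvent `(T - z)⁻¹` (with the value `0` if `z` is not in the resolvent set of `T`). -/
def resolventOp (T : K →ₗ.[ℂ] K) (z : ℂ) : K →L[ℂ] K :=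
  if h : ∃ R, IsResolventAt T z R then h.choose else 0

/-- The compression `P_H (T - z)⁻¹ |_H` of the resolvent of `T`, where `H` is regarded as a
subspace of `K` through the isometry `ι` (so that the adjoint of `ι` is the orthogonal projection
of `K` onto `H`). -/
def compressedResolvent (ι : H →ₗᵢ[ℂ] K) (T : K →ₗ.[ℂ] K) (z : ℂ) : H →L[ℂ] H :=
  ContinuousLinearMap.adjoint ι.toContinuousLinearMap ∘L resolventOp T z ∘L
    ι.toContinuousLinearMap

/-- `T` is a self-adjoint operator in `K ⊃ H` with `A ⊂ T`. -/
structure IsSelfAdjointExtension (A : H →ₗ.[ℂ] H) (ι : H →ₗᵢ[ℂ] K) (T : K →ₗ.[ℂ] K) : Prop where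
  dense : Dense (T.domain : Set K)
  adjoint_eq : T† = T
  extends_op : ∀ x : A.domain, ∃ h : ι x ∈ T.domain, T ⟨ι x, h⟩ = ι (A x)

/-- The closed subspace `M` reduces `T`: `P_M T ⊂ T P_M`. (In a Hilbert space the closed subspaces
are exactly those that admit an orthogonal projection.) -/
def IsReducing (T : K →ₗ.[ℂ] K) (M : Submodule ℂ K) [M.HasOrthogonalProjection] : Prop :=
  ∀ x : T.domain, ∃ h : M.starProjection (x : K) ∈ T.domain,
    T ⟨M.starProjection (x : K), h⟩ = M.starProjection (T x)

/-- No nontrivial closed subspace of `K ⊖ H` is reducing for `T`. -/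
def IsMinimalExtension (ι : H →ₗᵢ[ℂ] K) (T : K →ₗ.[ℂ] K) : Prop :=
  ∀ (M : Submodule ℂ K) [M.HasOrthogonalProjection],
    M ≤ (LinearMap.range ι.toLinearMap)ᗮ → IsReducing T M → M = ⊥

/-- The closed linear span of all `(T - z)⁻¹ x`, `x ∈ H`, `z ∈ ℂ \ ℝ`. -/
def resolventSpan (ι : H →ₗᵢ[ℂ] K) (T : K →ₗ.[ℂ] K) : Submodule ℂ K :=
  (Submodule.span ℂ {y : K | ∃ (x : H) (z : ℂ), z.im ≠ 0 ∧ y = resolventOp T z (ι x)})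
    |>.topologicalClosure

/-- The embedding `x ↦ (x, 0)` of `H` into the orthogonal sum `H ⊕ F`. -/
def inclFst (H F : Type*) [NormedAddCommGroup H] [InnerProductSpace ℂ H]
    [NormedAddCommGroup F] [InnerProductSpace ℂ F] : H →ₗᵢ[ℂ] WithLp 2 (H × F) where
  toLinearMap :=
    (WithLp.linearEquiv 2 ℂ (H × F)).symm.toLinearMap ∘ₗ LinearMap.inl ℂ H F
  norm_map' x := WithLp.norm_toLp_fst 2 H F x

end Operators

/-! ### Herglotz–Nevanlinna functions -/

/-- `f` is holomorphic on the open upper half-plane with `Im f ≥ 0` there (the values of `f`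
elsewhere are irrelevant). -/
def IsHerglotzNevanlinna (f : ℂ → ℂ) : Prop :=
  DifferentiableOn ℂ f {z | 0 < z.im} ∧ ∀ z : ℂ, 0 < z.im → 0 ≤ (f z).im

/-- The extension of `f` from the upper half-plane to `ℂ \ ℝ` by `f(z) = conj (f (conj z))`. -/
def symmExtend (f : ℂ → ℂ) (z : ℂ) : ℂ := if 0 < z.im then f z else conj (f (conj z))

/-- The data `h₀ ≥ 0`, `h ∈ ℝ`, and a Borel measure `σ` on `ℝ` with `∫ dσ(t)/(1+t²) < ∞`. -/
structure NevanlinnaData where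
  h₀ : ℝ
  h : ℝ
  σ : Measure ℝ
  h₀_nonneg : 0 ≤ h₀
  integrable : Integrable (fun t : ℝ => 1 / (1 + t ^ 2)) σ

/-- `f(z) = h₀ z + h + ∫ (1/(t-z) - t/(1+t²)) dσ(t)` for `z` in the upper half-plane. -/
def NevanlinnaData.Represents (d : NevanlinnaData) (f : ℂ → ℂ) : Prop :=
  ∀ z : ℂ, 0 < z.im →
    f z = d.h₀ * z + d.h + ∫ t : ℝ, (1 / ((t : ℂ) - z) - (t : ℂ) / (1 + (t : ℂ) ^ 2)) ∂d.σ

/-- `R` is the generalized resolvent `R_f` of `A`: it is holomorphic on `ℂ \ ℝ`, and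
`y = R(z) x` is the unique solution of `A† y - z y = x` that satisfies the
boundary condition `Γ₁ y + f(z) Γ₀ y = 0`. -/
structure IsGeneralizedResolventFor {H : Type*} [NormedAddCommGroup H] [InnerProductSpace ℂ H]
    [CompleteSpace H] {A : H →ₗ.[ℂ] H} (Γ : BoundaryTriplet A) (f : ℂ → ℂ)
    (R : ℂ → H →L[ℂ] H) : Prop where
  holomorphic : DifferentiableOn ℂ R {z | z.im ≠ 0}
  eq_iff : ∀ z : ℂ, z.im ≠ 0 → ∀ x y : H, R z x = y ↔
    ∃ hy : y ∈ A†.domain, A† ⟨y, hy⟩ - z • y = x ∧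
      Γ.Γ₁ ⟨y, hy⟩ + symmExtend f z * Γ.Γ₀ ⟨y, hy⟩ = 0

/-! ### The one-dimensional space `ℂ` with inner product `x * conj y / w` -/

/-- The space `ℂ` with the inner product `⟨x, y⟩ = x * conj y / w`, where `w > 0`. -/
structure WeightedLine (w : ℝ) (hw : 0 < w) where
  val : ℂ

namespace WeightedLine

variable {w : ℝ} {hw : 0 < w}

def equivC (w : ℝ) (hw : 0 < w) : WeightedLine w hw ≃ ℂ where
  toFun := val
  invFun := mk
  left_inv _ := rfl
  right_inv _ := rfl

instance : AddCommGroup (WeightedLine w hw) := (equivC w hw).addCommGroup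

instance : Module ℂ (WeightedLine w hw) := (equivC w hw).module ℂ

/-- The identity map onto `ℂ`, as a linear equivalence. -/
def toC (w : ℝ) (hw : 0 < w) : WeightedLine w hw ≃ₗ[ℂ] ℂ := (equivC w hw).linearEquiv ℂ

/-- The inner product, linear in `y` as in Mathlib. -/
@[reducible] def core (w : ℝ) (hw : 0 < w) : InnerProductSpace.Core ℂ (WeightedLine w hw) where
  inner x y := toC w hw y * conj (toC w hw x) / w
  conj_inner_symm x y := by simp [mul_comm]
  re_inner_nonneg x := by
    rw [Complex.mul_conj, ← Complex.ofReal_div]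
    exact div_nonneg (Complex.normSq_nonneg _) hw.le
  add_left x y z := by simp; ring
  smul_left x y r := by simp; ring
  definite x hx := by
    have hw' : (w : ℂ) ≠ 0 := by exact_mod_cast hw.ne'
    have h := (div_eq_zero_iff.mp hx).resolve_right hw'
    rw [Complex.mul_conj, Complex.ofReal_eq_zero, Complex.normSq_eq_zero] at h
    exact (LinearEquiv.map_eq_zero_iff _).mp h

instance : NormedAddCommGroup (WeightedLine w hw) := (core w hw).toNormedAddCommGroup

instance : InnerProductSpace ℂ (WeightedLine w hw) := InnerProductSpace.ofCore (core w hw).toCore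

instance : FiniteDimensional ℂ (WeightedLine w hw) := (toC w hw).symm.finiteDimensional

instance : CompleteSpace (WeightedLine w hw) := FiniteDimensional.complete ℂ _

theorem inner_def (x y : WeightedLine w hw) :
    inner ℂ x y = toC w hw y * conj (toC w hw x) / w := rfl

end WeightedLine

/-! ### The operations of the model operator on `L²(ℝ; dσ)` -/

namespace NevanlinnaData

variable (d : NevanlinnaData)

/-- `L²(ℝ; dσ)`. -/
abbrev L2 : Type := Lp ℂ 2 d.σ

/-- The pairs `(x₁, c) ∈ L²(σ) × ℂ` such that `t x₁(t) - c` belongs to `L²(σ)`. -/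
def mulDomain : Submodule ℂ (d.L2 × ℂ) where
  carrier := {p | MemLp (fun t : ℝ => (t : ℂ) * p.1 t - p.2) 2 d.σ}
  zero_mem' := by
    refine (memLp_congr_ae ?_).mpr (MemLp.zero (ε := ℂ))
    filter_upwards [Lp.coeFn_zero ℂ 2 d.σ] with t ht
    simp only [Prod.fst_zero, Prod.snd_zero, ht, Pi.zero_apply, mul_zero, sub_zero]
  add_mem' {p q} hp hq := by
    refine (memLp_congr_ae ?_).mpr (MemLp.add hp hq)
    filter_upwards [Lp.coeFn_add p.1 q.1] with t ht
    simp only [Prod.fst_add, Prod.snd_add, ht, Pi.add_apply]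
    ring
  smul_mem' c p hp := by
    refine (memLp_congr_ae ?_).mpr (MemLp.const_smul hp c)
    filter_upwards [Lp.coeFn_smul c p.1] with t ht
    simp only [Prod.smul_fst, Prod.smul_snd, ht, Pi.smul_apply, smul_eq_mul]
    ring

theorem memLp_of_mem (p : d.mulDomain) :
    MemLp (fun t : ℝ => (t : ℂ) * p.1.1 t - p.1.2) 2 d.σ := p.2

/-- The map `(x₁, c) ↦ t x₁(t) - c`. -/
def mulMap : d.mulDomain →ₗ[ℂ] d.L2 where
  toFun p := (d.memLp_of_mem p).toLp (fun t : ℝ => (t : ℂ) * p.1.1 t - p.1.2)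
  map_add' p q := by
    rw [← MemLp.toLp_add]
    refine MemLp.toLp_congr _ _ ?_
    filter_upwards [Lp.coeFn_add p.1.1 q.1.1] with t ht
    simp only [Submodule.coe_add, Prod.fst_add, Prod.snd_add, ht, Pi.add_apply]
    ring
  map_smul' c p := by
    rw [RingHom.id_apply, ← MemLp.toLp_const_smul]
    refine MemLp.toLp_congr _ _ ?_
    filter_upwards [Lp.coeFn_smul c p.1.1] with t ht
    simp only [Submodule.coe_smul, Prod.smul_fst, Prod.smul_snd, ht, Pi.smul_apply, smul_eq_mul]
    ring

/-- The integral that defines `intMap` converges absolutely. -/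
theorem integrable_of_mem (p : d.mulDomain) :
    Integrable (fun t : ℝ => p.1.1 t - (t : ℂ) / (1 + (t : ℂ) ^ 2) * p.1.2) d.σ := by
  have hsq : ∀ t : ℝ, (0 : ℝ) < 1 + t ^ 2 := fun t => by positivity
  have hm1 : Measurable fun t : ℝ => ((1 / (1 + t ^ 2) : ℝ) : ℂ) := by
    apply Complex.measurable_ofReal.comp; fun_prop
  have hm2 : Measurable fun t : ℝ => ((t / (1 + t ^ 2) : ℝ) : ℂ) := by
    apply Complex.measurable_ofReal.comp; fun_prop
  have h1 : MemLp (fun t : ℝ => ((1 / (1 + t ^ 2) : ℝ) : ℂ)) 2 d.σ := by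
    rw [memLp_two_iff_integrable_sq_norm hm1.aestronglyMeasurable]
    refine d.integrable.mono' (hm1.norm.pow_const 2).aestronglyMeasurable
      (Filter.Eventually.of_forall fun t => ?_)
    have : 1 / (1 + t ^ 2) ≤ 1 := by
      rw [div_le_one (hsq t)]; nlinarith [sq_nonneg t]
    have h0 : 0 ≤ 1 / (1 + t ^ 2) := by positivity
    rw [Complex.norm_real, Real.norm_of_nonneg (by positivity), Real.norm_of_nonneg h0]
    nlinarith
  have h2 : MemLp (fun t : ℝ => ((t / (1 + t ^ 2) : ℝ) : ℂ)) 2 d.σ := by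
    rw [memLp_two_iff_integrable_sq_norm hm2.aestronglyMeasurable]
    refine d.integrable.mono' (hm2.norm.pow_const 2).aestronglyMeasurable
      (Filter.Eventually.of_forall fun t => ?_)
    rw [Complex.norm_real, Real.norm_of_nonneg (sq_nonneg _), Real.norm_eq_abs, sq_abs, div_pow,
      div_le_div_iff₀ (pow_pos (hsq t) 2) (hsq t)]
    nlinarith [sq_nonneg t]
  have h3 := (Lp.memLp p.1.1).integrable_mul h1
  have h4 := (d.memLp_of_mem p).integrable_mul h2
  refine (h3.add h4).congr (Filter.Eventually.of_forall fun t => ?_)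
  have : (1 + (t : ℂ) ^ 2) ≠ 0 := by exact_mod_cast (hsq t).ne'
  simp only [Pi.add_apply, Pi.mul_apply]
  push_cast
  field_simp
  ring

/-- The functional `(x₁, c) ↦ ∫ (x₁(t) - t/(1+t²) c) dσ(t)`. -/
def intMap : d.mulDomain →ₗ[ℂ] ℂ where
  toFun p := ∫ t : ℝ, (p.1.1 t - (t : ℂ) / (1 + (t : ℂ) ^ 2) * p.1.2) ∂d.σ
  map_add' p q := by
    rw [← integral_add (d.integrable_of_mem p) (d.integrable_of_mem q)]
    refine integral_congr_ae ?_
    filter_upwards [Lp.coeFn_add p.1.1 q.1.1] with t ht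
    simp only [Submodule.coe_add, Prod.fst_add, Prod.snd_add, ht, Pi.add_apply]
    ring
  map_smul' c p := by
    rw [RingHom.id_apply, smul_eq_mul, ← integral_const_mul]
    refine integral_congr_ae ?_
    filter_upwards [Lp.coeFn_smul c p.1.1] with t ht
    simp only [Submodule.coe_smul, Prod.smul_fst, Prod.smul_snd, ht, Pi.smul_apply, smul_eq_mul]
    ring

end NevanlinnaData

/-! ### The operator `Ã` -/

section Model

variable {H : Type*} [NormedAddCommGroup H] [InnerProductSpace ℂ H] [CompleteSpace H]
variable {A : H →ₗ.[ℂ] H}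

/-- The pairs `(x₀, x₁)` with `x₀ ∈ D(A†)`, `x₁ ∈ L²(σ)` and `t x₁(t) - Γ₀ x₀ ∈ L²(σ)`. -/
def pairDomain (Γ : BoundaryTriplet A) (d : NevanlinnaData) : Submodule ℂ (A†.domain × d.L2) :=
  d.mulDomain.comap
    ((LinearMap.snd ℂ A†.domain d.L2).prod (Γ.Γ₀ ∘ₗ LinearMap.fst ℂ A†.domain d.L2))

/-- The map `(x₀, x₁) ↦ (x₁, Γ₀ x₀)`. -/
def pairToMul (Γ : BoundaryTriplet A) (d : NevanlinnaData) : pairDomain Γ d →ₗ[ℂ] d.mulDomain :=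
  LinearMap.restrict
    ((LinearMap.snd ℂ A†.domain d.L2).prod (Γ.Γ₀ ∘ₗ LinearMap.fst ℂ A†.domain d.L2))
    fun _ h => h

/-- The functional `Γ₁ x₀ + h Γ₀ x₀ + ∫ (x₁(t) - t/(1+t²) Γ₀ x₀) dσ(t)`. -/
def pairFunctional (Γ : BoundaryTriplet A) (d : NevanlinnaData) : pairDomain Γ d →ₗ[ℂ] ℂ :=
  (Γ.Γ₁ + (d.h : ℂ) • Γ.Γ₀) ∘ₗ LinearMap.fst ℂ A†.domain d.L2 ∘ₗ (pairDomain Γ d).subtype +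
    d.intMap ∘ₗ pairToMul Γ d

/-- The space `H ⊕ L²(σ)`, used when `h₀ = 0`. -/
abbrev SpaceZero (H : Type*) [NormedAddCommGroup H] [InnerProductSpace ℂ H]
    (d : NevanlinnaData) : Type _ := WithLp 2 (H × d.L2)

/-- The space `H ⊕ L²(σ) ⊕ ℂ`, used when `h₀ > 0`, with inner product
`⟨x₀, y₀⟩ + ∫ x₁ conj y₁ dσ + x₂ conj y₂ / h₀`. -/
abbrev SpacePos (H : Type*) [NormedAddCommGroup H] [InnerProductSpace ℂ H]
    (d : NevanlinnaData) (hd : 0 < d.h₀) : Type _ :=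
  WithLp 2 (H × WithLp 2 (d.L2 × WeightedLine d.h₀ hd))

/-- The domain of `Ã` when `h₀ = 0`: all `(x₀, x₁)` such that `x₀ ∈ D(A†)`,
`t x₁(t) - Γ₀ x₀ ∈ L²(σ)` and `Γ₁ x₀ + h Γ₀ x₀ + ∫ (x₁(t) - t/(1+t²) Γ₀ x₀) dσ(t) = 0`. -/
def domainZero (Γ : BoundaryTriplet A) (d : NevanlinnaData) : Submodule ℂ (SpaceZero H d) where
  carrier := {x | ∃ p : pairDomain Γ d, (p.1.1 : H) = x.fst ∧ p.1.2 = x.snd ∧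
    pairFunctional Γ d p = 0}
  zero_mem' := ⟨0, rfl, rfl, map_zero _⟩
  add_mem' := by
    rintro x y ⟨p, hp, hp', hp''⟩ ⟨q, hq, hq', hq''⟩
    refine ⟨p + q, ?_, ?_, ?_⟩
    · simp [hp, hq]
    · simp [hp', hq']
    · simp [hp'', hq'']
  smul_mem' c := by
    rintro x ⟨p, hp, hp', hp''⟩
    refine ⟨c • p, ?_, ?_, ?_⟩
    · simp [hp]
    · simp [hp']
    · simp [hp'']

/-- The components `(x₀, x₁)` of an element of the domain of `Ã` when `h₀ = 0`. -/
def pairOfZero (Γ : BoundaryTriplet A) (d : NevanlinnaData) :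
    domainZero Γ d →ₗ[ℂ] pairDomain Γ d where
  toFun x := ⟨(⟨x.1.fst, by obtain ⟨p, hp, -⟩ := x.2; exact hp ▸ p.1.1.2⟩, x.1.snd), by
    obtain ⟨x, p, hp, hp', -⟩ := x
    have h := p.2
    convert h using 1
    exact Prod.ext (Subtype.ext hp.symm) hp'.symm⟩
  map_add' _ _ := rfl
  map_smul' _ _ := rfl

/-- The operator `Ã (x₀, x₁) = (A† x₀, t x₁ - Γ₀ x₀)`, when `h₀ = 0`. -/
def modelZero (Γ : BoundaryTriplet A) (d : NevanlinnaData) :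
    SpaceZero H d →ₗ.[ℂ] SpaceZero H d where
  domain := domainZero Γ d
  toFun := (WithLp.linearEquiv 2 ℂ (H × d.L2)).symm.toLinearMap ∘ₗ
    ((A†.toFun ∘ₗ LinearMap.fst ℂ A†.domain d.L2 ∘ₗ (pairDomain Γ d).subtype).prod
      (d.mulMap ∘ₗ pairToMul Γ d)) ∘ₗ pairOfZero Γ d

/-- The domain of `Ã` when `h₀ > 0`: all `(x₀, x₁, x₂)` such that `x₀ ∈ D(A†)`,
`t x₁(t) - Γ₀ x₀ ∈ L²(σ)` and `x₂ = -h₀ Γ₀ x₀`. -/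
def domainPos (Γ : BoundaryTriplet A) (d : NevanlinnaData) (hd : 0 < d.h₀) :
    Submodule ℂ (SpacePos H d hd) where
  carrier := {x | ∃ p : pairDomain Γ d, (p.1.1 : H) = x.fst ∧ p.1.2 = x.snd.fst ∧
    WeightedLine.toC d.h₀ hd x.snd.snd = -(d.h₀ : ℂ) * Γ.Γ₀ p.1.1}
  zero_mem' := ⟨0, rfl, rfl, by simp⟩
  add_mem' := by
    rintro x y ⟨p, hp, hp', hp''⟩ ⟨q, hq, hq', hq''⟩
    refine ⟨p + q, ?_, ?_, ?_⟩
    · simp [hp, hq]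
    · simp [hp', hq']
    · simp [hp'', hq'', mul_add]; try ring
  smul_mem' c := by
    rintro x ⟨p, hp, hp', hp''⟩
    refine ⟨c • p, ?_, ?_, ?_⟩
    · simp [hp]
    · simp [hp']
    · simp [hp'']; try ring

/-- The components `(x₀, x₁)` of an element of the domain of `Ã` when `h₀ > 0`. -/
def pairOfPos (Γ : BoundaryTriplet A) (d : NevanlinnaData) (hd : 0 < d.h₀) :
    domainPos Γ d hd →ₗ[ℂ] pairDomain Γ d where
  toFun x := ⟨(⟨x.1.fst, by obtain ⟨p, hp, -⟩ := x.2; exact hp ▸ p.1.1.2⟩, x.1.snd.fst), by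
    obtain ⟨x, p, hp, hp', -⟩ := x
    have h := p.2
    convert h using 1
    exact Prod.ext (Subtype.ext hp.symm) hp'.symm⟩
  map_add' _ _ := rfl
  map_smul' _ _ := rfl

/-- The operator `Ã (x₀, x₁, x₂) =
(A† x₀, t x₁ - Γ₀ x₀, Γ₁ x₀ + h Γ₀ x₀ + ∫ (x₁(t) - t/(1+t²) Γ₀ x₀) dσ(t))`, when `h₀ > 0`. -/
def modelPos (Γ : BoundaryTriplet A) (d : NevanlinnaData) (hd : 0 < d.h₀) :
    SpacePos H d hd →ₗ.[ℂ] SpacePos H d hd where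
  domain := domainPos Γ d hd
  toFun := (WithLp.linearEquiv 2 ℂ (H × WithLp 2 (d.L2 × WeightedLine d.h₀ hd))).symm.toLinearMap ∘ₗ
    ((A†.toFun ∘ₗ LinearMap.fst ℂ A†.domain d.L2 ∘ₗ (pairDomain Γ d).subtype).prod
      ((WithLp.linearEquiv 2 ℂ (d.L2 × WeightedLine d.h₀ hd)).symm.toLinearMap ∘ₗ
        (d.mulMap ∘ₗ pairToMul Γ d).prod
          ((WeightedLine.toC d.h₀ hd).symm.toLinearMap ∘ₗ pairFunctional Γ d))) ∘ₗ
    pairOfPos Γ d hd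

end Model

/-- `T` is a minimal self-adjoint extension of `A` (in both equivalent senses of minimality), and
its compressed resolvent is the generalized resolvent `R_f`. -/
structure IsMinimalExtensionFor {H K : Type*} [NormedAddCommGroup H] [InnerProductSpace ℂ H]
    [CompleteSpace H] [NormedAddCommGroup K] [InnerProductSpace ℂ K] [CompleteSpace K]
    {A : H →ₗ.[ℂ] H} (Γ : BoundaryTriplet A) (f : ℂ → ℂ) (ι : H →ₗᵢ[ℂ] K)
    (T : K →ₗ.[ℂ] K) : Prop where
  selfAdjointExtension : IsSelfAdjointExtension A ι T
  minimal : IsMinimalExtension ι T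
  span_dense : resolventSpan ι T = ⊤
  resolvent_exists : ∀ z : ℂ, z.im ≠ 0 → IsResolventAt T z (resolventOp T z)
  generalizedResolvent : IsGeneralizedResolventFor Γ f (compressedResolvent ι T)

end

/-!
The model operator couples two halves along an interface. One half is `A†` with the boundary maps
`Γ₀, Γ₁`. The other half lives in `F = L²(σ)` (or `L²(σ) ⊕ ℂ`): it is the relation
`u' = t u - c`, `e = h c + ∫ (u - t / (1 + t²) c) dσ`, with boundary values `c, e`. If `h₀ > 0`, the
additional component of `u` is `-h₀ c` and that of `u'` is subtracted from `e`, which accounts for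
the summand `h₀ z` of `f` and changes nothing else in the argument. Both halves satisfy a Green identity, and `Ã` is defined by the interface conditions `c = Γ₀ x`, `e = -Γ₁ x`,
under which the two boundary forms cancel; hence `Ã` is symmetric. The solutions of `u' = z u` are
the multiples of `u = 1 / (t - z)`, with `c = 1` and `e = f z`, so that `f` is the Weyl function of
the second half, and eliminating `u` from `(Ã - z) (y, u) = (x, 0)` leaves exactly
`A† y - z y = x`, `Γ₁ y + f z * Γ₀ y = 0`.

Self-adjointness follows from surjectivity of `Ã - z` for all nonreal `z` (`IsSymmetricOnto`). This
reduces to solving the boundary value problem above (`IsCoupling.exists_boundary`): `A† - z` is onto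
because `A - z̄` is bounded below; uniqueness of solutions comes from symmetry of `Ã`; existence
follows because `A† - z` has a nonzero kernel (`BoundaryTriplet.exists_ne_zero_adjoint_eq_smul`), on
which the boundary functional cannot vanish.

For minimality, a vector orthogonal to all `(Ã - z)⁻¹ x`, `x ∈ H`, turns out to be orthogonal to `H`
and to all `1 / (t - z)`. The latter functions are complete in `L²(σ)`
(`ae_eq_zero_of_integral_mul_inv_eq_zero`): by differentiation in `z` and partial fractions, such a
vector is orthogonal to all products of `1 / (t - i)` and `1 / (t + i)`, and the Stone–Weierstrass
theorem on the one-point compactification of `ℝ` applies. When `h₀ > 0`, the additional component is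
recovered from the limit `z → i ∞`.

The integral representation of `f` is transported from the unit disc by the Cayley transform. There
it is Herglotz's theorem (`exists_finiteMeasure_herglotz`): the Schwarz formula on circles of radius
`r < 1`, followed by a weak limit of the measures as `r → 1`.
-/

/-! ### Symmetric operators whose resolvents exist -/

section SymmetricOperators

variable {K : Type*} [NormedAddCommGroup K] [InnerProductSpace ℂ K]
  {T : K →ₗ.[ℂ] K}

/-- The imaginary part of `⟪x, (T - z) x⟫` is `-Im z ‖x‖²`, since `⟪x, T x⟫` is real. -/
theorem LinearPMap.IsFormalAdjoint.abs_im_mul_norm_le (hT : T.IsFormalAdjoint T) (z : ℂ)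
    (x : T.domain) : |z.im| * ‖(x : K)‖ ≤ ‖T x - z • (x : K)‖ := by
  rcases eq_or_ne (x : K) 0 with hx | hx
  · simp [hx]
  have hreal : (inner ℂ (x : K) (T x)).im = 0 := by
    rw [← Complex.conj_eq_iff_im, inner_conj_symm, hT x x]
  have him : (inner ℂ (x : K) (T x - z • (x : K))).im = -(z.im * ‖(x : K)‖ ^ 2) := by
    rw [inner_sub_right, inner_smul_right, inner_self_eq_norm_sq_to_K, Complex.sub_im, hreal,
      zero_sub, neg_inj]
    norm_cast
    exact Complex.im_mul_ofReal _ _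
  have h1 : |z.im| * ‖(x : K)‖ ^ 2 ≤ ‖(x : K)‖ * ‖T x - z • (x : K)‖ := by
    calc |z.im| * ‖(x : K)‖ ^ 2 = |(inner ℂ (x : K) (T x - z • (x : K))).im| := by
          rw [him, abs_neg, abs_mul, abs_of_nonneg (sq_nonneg ‖(x : K)‖)]
      _ ≤ ‖inner ℂ (x : K) (T x - z • (x : K))‖ := Complex.abs_im_le_norm _
      _ ≤ _ := norm_inner_le_norm _ _
  have hpos : 0 < ‖(x : K)‖ := norm_pos_iff.2 hx
  nlinarith

theorem LinearPMap.IsFormalAdjoint.eq_zero_of_apply_eq_smul (hT : T.IsFormalAdjoint T) {z : ℂ}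
    (hz : z.im ≠ 0) (x : T.domain) (hx : T x - z • (x : K) = 0) : (x : K) = 0 := by
  have h := hT.abs_im_mul_norm_le z x
  rw [hx, norm_zero] at h
  exact norm_eq_zero.1 (le_antisymm (nonpos_of_mul_nonpos_right h (abs_pos.2 hz)) (norm_nonneg _))

theorem IsResolventAt.unique {z : ℂ} {R S : K →L[ℂ] K} (hR : IsResolventAt T z R)
    (hS : IsResolventAt T z S) : R = S := by
  ext x
  obtain ⟨h, hx⟩ := hR.1 x
  simpa [hx] using (hS.2 ⟨R x, h⟩).symm

theorem resolventOp_eq {z : ℂ} {R : K →L[ℂ] K} (hR : IsResolventAt T z R) :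
    resolventOp T z = R := by
  have h : ∃ R, IsResolventAt T z R := ⟨R, hR⟩
  rw [resolventOp, dif_pos h]
  exact h.choose_spec.unique hR

/-- A symmetric operator with `T - z` onto for every nonreal `z` has a resolvent there: injectivity
and boundedness of the inverse come from `|Im z| ‖x‖ ≤ ‖(T - z) x‖`. -/
theorem LinearPMap.IsFormalAdjoint.isResolventAt_resolventOp (hT : T.IsFormalAdjoint T) {z : ℂ}
    (hz : z.im ≠ 0) (hsurj : ∀ y : K, ∃ x : T.domain, T x - z • (x : K) = y) :
    IsResolventAt T z (resolventOp T z) := by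
  let S : T.domain →ₗ[ℂ] K := T.toFun - z • T.domain.subtype
  have hS : ∀ x : T.domain, S x = T x - z • (x : K) := fun x => rfl
  have hbij : Function.Bijective S := by
    refine ⟨(injective_iff_map_eq_zero S).2 fun x hx => ?_, fun y => hsurj y⟩
    exact Subtype.ext (hT.eq_zero_of_apply_eq_smul hz x hx)
  let e := LinearEquiv.ofBijective S hbij
  have he : ∀ y, T (e.symm y) - z • (e.symm y : K) = y := fun y => e.apply_symm_apply y
  let R : K →L[ℂ] K := (T.domain.subtype ∘ₗ e.symm.toLinearMap).mkContinuous |z.im|⁻¹ fun y => by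
    have h := hT.abs_im_mul_norm_le z (e.symm y)
    rw [he] at h
    exact (le_inv_mul_iff₀ (abs_pos.2 hz)).2 h
  have hR : IsResolventAt T z R :=
    ⟨fun y => ⟨(e.symm y).2, he y⟩, fun x => congrArg Subtype.val (e.symm_apply_apply x)⟩
  rwa [resolventOp_eq hR]

/-- A symmetric operator with `T - z` onto for every nonreal `z`. By von Neumann's criterion these
are exactly the self-adjoint operators. -/
structure IsSymmetricOnto (T : K →ₗ.[ℂ] K) : Prop where
  symm : T.IsFormalAdjoint T
  onto : ∀ z : ℂ, z.im ≠ 0 → ∀ y : K, ∃ x : T.domain, T x - z • (x : K) = y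

namespace IsSymmetricOnto

variable (hT : IsSymmetricOnto T)
include hT

theorem isResolventAt {z : ℂ} (hz : z.im ≠ 0) : IsResolventAt T z (resolventOp T z) :=
  hT.symm.isResolventAt_resolventOp hz (hT.onto z hz)

theorem norm_resolventOp_le {z : ℂ} (hz : z.im ≠ 0) : ‖resolventOp T z‖ ≤ |z.im|⁻¹ := by
  refine ContinuousLinearMap.opNorm_le_bound _ (inv_nonneg.2 (abs_nonneg _)) fun y => ?_
  obtain ⟨h, hy⟩ := (hT.isResolventAt hz).1 y
  have := hT.symm.abs_im_mul_norm_le z ⟨_, h⟩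
  rw [hy] at this
  exact (le_inv_mul_iff₀ (abs_pos.2 hz)).2 this

/-- The first resolvent identity. -/
theorem resolventOp_sub {z w : ℂ} (hz : z.im ≠ 0) (hw : w.im ≠ 0) :
    resolventOp T z - resolventOp T w = (z - w) • (resolventOp T w ∘L resolventOp T z) := by
  ext y
  obtain ⟨h, hy⟩ := (hT.isResolventAt hz).1 y
  have := (hT.isResolventAt hw).2 ⟨_, h⟩
  have h2 : T ⟨_, h⟩ - w • resolventOp T z y = y + (z - w) • resolventOp T z y := by
    rw [sub_smul, ← add_sub_assoc, sub_left_inj]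
    exact sub_eq_iff_eq_add.1 hy
  rw [h2, map_add, map_smul] at this
  exact sub_eq_iff_eq_add'.2 this.symm

theorem inner_resolventOp {z : ℂ} (hz : z.im ≠ 0) (x y : K) :
    inner ℂ (resolventOp T z x) y = inner ℂ x (resolventOp T (conj z) y) := by
  have hz' : (conj z).im ≠ 0 := by simpa using hz
  obtain ⟨h, hx⟩ := (hT.isResolventAt hz).1 x
  obtain ⟨h', hy⟩ := (hT.isResolventAt hz').1 y
  nth_rw 1 [← hy]
  nth_rw 2 [← hx]
  rw [inner_sub_left, inner_sub_right, inner_smul_left, inner_smul_right,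
    hT.symm ⟨_, h⟩ ⟨_, h'⟩]

theorem differentiableOn_resolventOp :
    DifferentiableOn ℂ (fun z => resolventOp T z) {z : ℂ | z.im ≠ 0} := by
  intro w hw
  have hU : {z : ℂ | z.im ≠ 0} ∈ nhds w :=
    (isOpen_ne_fun Complex.continuous_im continuous_const).mem_nhds hw
  have hcont : ContinuousAt (fun z => resolventOp T z) w := by
    rw [ContinuousAt, tendsto_iff_norm_sub_tendsto_zero]
    have hlim : Filter.Tendsto (fun z : ℂ => ‖z - w‖ * (|w.im|⁻¹ * |z.im|⁻¹)) (nhds w)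
        (nhds (‖w - w‖ * (|w.im|⁻¹ * |w.im|⁻¹))) := by
      refine Filter.Tendsto.mul
        (Continuous.tendsto (by fun_prop) w) (Filter.Tendsto.mul tendsto_const_nhds ?_)
      exact ((Complex.continuous_im.abs).continuousAt).inv₀ (abs_ne_zero.2 hw)
    rw [sub_self, norm_zero, zero_mul] at hlim
    refine tendsto_of_tendsto_of_tendsto_of_le_of_le' tendsto_const_nhds hlim
      (Filter.Eventually.of_forall fun _ => norm_nonneg _) ?_
    filter_upwards [hU] with z hz
    rw [hT.resolventOp_sub hz hw, norm_smul]
    gcongr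
    refine (ContinuousLinearMap.opNorm_comp_le _ _).trans ?_
    exact mul_le_mul (hT.norm_resolventOp_le hw) (hT.norm_resolventOp_le hz) (norm_nonneg _)
      (inv_nonneg.2 (abs_nonneg _))
  refine DifferentiableAt.differentiableWithinAt (HasDerivAt.differentiableAt
    (f' := resolventOp T w ∘L resolventOp T w) ?_)
  rw [hasDerivAt_iff_tendsto_slope]
  have hlim : Filter.Tendsto (fun z => resolventOp T w ∘L resolventOp T z) (nhdsWithin w {w}ᶜ)
      (nhds (resolventOp T w ∘L resolventOp T w)) :=
    ((continuous_const.clm_comp continuous_id).continuousAt.comp hcont).mono_left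
      nhdsWithin_le_nhds
  refine hlim.congr' ?_
  filter_upwards [nhdsWithin_le_nhds hU, self_mem_nhdsWithin] with z hz hne
  rw [slope_def_module, hT.resolventOp_sub hz hw, smul_smul,
    inv_mul_cancel₀ (sub_ne_zero.2 hne), one_smul]

/-- If `w` is orthogonal to the domain and `w = (T - i) x`, then `x` is orthogonal to the range of
`T + i`, hence zero. -/
theorem dense_domain [CompleteSpace K] : Dense (T.domain : Set K) := by
  rw [Submodule.dense_iff_topologicalClosure_eq_top, Submodule.topologicalClosure_eq_top_iff,
    Submodule.eq_bot_iff]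
  intro w hw
  obtain ⟨x, rfl⟩ := hT.onto Complex.I (by simp) w
  obtain ⟨v, hv⟩ := hT.onto (-Complex.I) (by simp) x
  have h : inner ℂ (x : K) (x : K) = 0 := by
    have h0 := (Submodule.mem_orthogonal' _ _).1 hw v v.2
    rw [inner_sub_left, inner_smul_left, hT.symm x v] at h0
    nth_rw 2 [← hv]
    rw [inner_sub_right, inner_smul_right]
    simpa using h0
  have hx : x = 0 := Subtype.ext (inner_self_eq_zero.1 h)
  simp [hx]

theorem adjoint_eq [CompleteSpace K] : T† = T := by
  have hd := hT.dense_domain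
  refine le_antisymm ?_ (hT.symm.le_adjoint hd)
  -- If `(T - i) x = (T† - i) y`, then `x - y` is orthogonal to the range of `T + i`, hence zero.
  have hdom : ∀ y : T†.domain, ∃ x : T.domain, (x : K) = y ∧ T x = T† y := by
    intro y
    obtain ⟨x, hx⟩ := hT.onto Complex.I (by simp) (T† y - Complex.I • (y : K))
    obtain ⟨v, hv⟩ := hT.onto (-Complex.I) (by simp) ((x : K) - y)
    have hxy : (x : K) - y = 0 := by
      rw [← inner_self_eq_zero (𝕜 := ℂ)]
      nth_rw 2 [← hv]
      have h1 := LinearPMap.adjoint_isFormalAdjoint hd y v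
      have h2 := hT.symm x v
      have h3 : inner ℂ (T x - Complex.I • (x : K)) (v : K)
          = inner ℂ (T† y - Complex.I • (y : K)) (v : K) := by rw [hx]
      rw [inner_sub_left, inner_sub_left, inner_smul_left, inner_smul_left, h1, h2] at h3
      rw [inner_sub_right, inner_smul_right, inner_sub_left, inner_sub_left]
      simp only [Complex.conj_I] at h3
      linear_combination h3
    rw [sub_eq_zero] at hxy
    refine ⟨x, hxy, ?_⟩
    rw [hxy] at hx
    exact sub_left_injective hx
  refine ⟨fun y hy => ?_, fun y x hyx => ?_⟩
  · obtain ⟨x, hx, -⟩ := hdom ⟨y, hy⟩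
    have hx' : (x : K) = y := hx
    exact hx' ▸ x.2
  · obtain ⟨x', hx', h⟩ := hdom y
    rw [← h]
    exact congrArg _ (Subtype.ext (hx'.trans hyx))

/-- A reducing subspace orthogonal to `H` is annihilated by its own projection on every
`(T - z)⁻¹ x`, `x ∈ H`, because the projection commutes with the resolvent. -/
theorem isMinimalExtension [CompleteSpace K] {H : Type*} [NormedAddCommGroup H]
    [InnerProductSpace ℂ H] [CompleteSpace H] (ι : H →ₗᵢ[ℂ] K) (hspan : resolventSpan ι T = ⊤) :
    IsMinimalExtension ι T := by
  intro M _ hM hred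
  have hker : resolventSpan ι T ≤ M.starProjection.ker := by
    refine Submodule.topologicalClosure_minimal _ ?_ M.starProjection.isClosed_ker
    rw [Submodule.span_le]
    rintro _ ⟨x, z, hz, rfl⟩
    obtain ⟨h, hx⟩ := (hT.isResolventAt hz).1 (ι x)
    obtain ⟨h', hx'⟩ := hred ⟨_, h⟩
    have hιx : M.starProjection (ι x) = 0 := by
      rw [Submodule.starProjection_apply_eq_zero_iff]
      exact Submodule.mem_orthogonal' _ _ |>.2 fun u hu =>
        (Submodule.mem_orthogonal _ _).1 (hM hu) _ ⟨x, rfl⟩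
    have := hT.symm.eq_zero_of_apply_eq_smul hz ⟨_, h'⟩ (by
      rw [hx', ← map_smul, ← map_sub, hx, hιx])
    exact this
  rw [Submodule.eq_bot_iff]
  intro x hx
  have : x ∈ M.starProjection.ker := hker (hspan ▸ Submodule.mem_top)
  rw [← Submodule.starProjection_eq_self_iff.2 hx]
  exact this

end IsSymmetricOnto

end SymmetricOperators

/-! ### Boundary triplets and defect elements -/

namespace BoundaryTriplet

variable {H : Type*} [NormedAddCommGroup H] [InnerProductSpace ℂ H] [CompleteSpace H]
  {A : H →ₗ.[ℂ] H}

/-- `A† - z` is onto: since `A - z̄` is bounded below, `(A - z̄) v ↦ ⟪x, v⟫` is a bounded functional on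
its range. Extended to `H` and represented by a vector `y`, it gives `(A† - z) y = x`. -/
theorem exists_adjoint_sub_smul_eq (hd : Dense (A.domain : Set H)) (hs : IsSymmetricOp A) {z : ℂ}
    (hz : z.im ≠ 0) (x : H) : ∃ y : A†.domain, A† y - z • (y : H) = x := by
  have hz' : (conj z).im ≠ 0 := by simpa using hz
  let S : A.domain →ₗ[ℂ] H := A.toFun - conj z • A.domain.subtype
  have hS : ∀ v : A.domain, S v = A v - conj z • (v : H) := fun v => rfl
  have hinj : Function.Injective S := (injective_iff_map_eq_zero S).2 fun v hv =>
    Subtype.ext (LinearPMap.IsFormalAdjoint.eq_zero_of_apply_eq_smul hs hz' v hv)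
  let e := LinearEquiv.ofInjective S hinj
  have he : ∀ v, (e v : H) = S v := fun v => rfl
  let φ : S.range →ₗ[ℂ] ℂ := (innerₛₗ ℂ x) ∘ₗ A.domain.subtype ∘ₗ e.symm.toLinearMap
  have hφ : ∀ u, ‖φ u‖ ≤ ‖x‖ * |(conj z).im|⁻¹ * ‖u‖ := by
    intro u
    have h := LinearPMap.IsFormalAdjoint.abs_im_mul_norm_le hs (conj z) (e.symm u)
    rw [← hS, ← he, e.apply_symm_apply] at h
    calc ‖φ u‖ ≤ ‖x‖ * ‖(e.symm u : H)‖ := norm_inner_le_norm _ _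
      _ ≤ ‖x‖ * (|(conj z).im|⁻¹ * ‖u‖) := by
        gcongr
        exact (le_inv_mul_iff₀ (abs_pos.2 hz')).2 h
      _ = _ := by ring
  obtain ⟨g, hg, -⟩ := exists_extension_norm_eq S.range (φ.mkContinuous _ hφ)
  set y := (InnerProductSpace.toDual ℂ H).symm g with hy
  have hyv : ∀ v : A.domain, inner ℂ (x + z • y) (v : H) = inner ℂ y (A v) := by
    intro v
    have h1 : inner ℂ y (S v) = inner ℂ x (v : H) := by
      rw [hy, InnerProductSpace.toDual_symm_apply, ← he, hg]
      change inner ℂ x (e.symm (e v) : H) = _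
      rw [e.symm_apply_apply]
    rw [hS, inner_sub_right, inner_smul_right] at h1
    rw [inner_add_left, inner_smul_left, ← h1]
    ring
  refine ⟨⟨y, LinearPMap.mem_adjoint_domain_of_exists y ⟨_, hyv⟩⟩, ?_⟩
  rw [LinearPMap.adjoint_apply_eq hd _ hyv, add_sub_cancel_right]

theorem mem_domain_adjoint (hd : Dense (A.domain : Set H)) (hs : IsSymmetricOp A) (a : A.domain) :
    ∃ h : (a : H) ∈ A†.domain, A† ⟨a, h⟩ = A a := by
  have hle := LinearPMap.IsFormalAdjoint.le_adjoint hd hs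
  exact ⟨hle.1 a.2, (hle.2 rfl).symm⟩

/-- The boundary maps vanish on `D(A)`, by the Green identity and their joint surjectivity. -/
theorem apply_eq_zero (Γ : BoundaryTriplet A) (hd : Dense (A.domain : Set H))
    (hs : IsSymmetricOp A) (a : A†.domain) (ha : (a : H) ∈ A.domain) :
    Γ.Γ₀ a = 0 ∧ Γ.Γ₁ a = 0 := by
  obtain ⟨h, haA⟩ := mem_domain_adjoint hd hs ⟨a, ha⟩
  have hg : ∀ y : A†.domain, Γ.Γ₁ a * conj (Γ.Γ₀ y) - Γ.Γ₀ a * conj (Γ.Γ₁ y) = 0 := by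
    intro y
    rw [← Γ.green, haA, sub_eq_zero]
    exact (LinearPMap.adjoint_isFormalAdjoint hd y ⟨a, ha⟩).symm
  obtain ⟨y, hy⟩ := Γ.surjective (1, 0)
  obtain ⟨y', hy'⟩ := Γ.surjective (0, 1)
  simp only [Prod.mk.injEq] at hy hy'
  have h1 := hg y
  have h2 := hg y'
  rw [hy.1, hy.2] at h1
  rw [hy'.1, hy'.2] at h2
  constructor
  · simpa using h2
  · simpa using h1

/-- The map `(v, w) ↦ w - z v` is bounded below on the closed graph of `A`, so its range is closed. -/
theorem isClosed_range_sub_smul (hc : A.IsClosed) (hs : IsSymmetricOp A) {z : ℂ}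
    (hz : z.im ≠ 0) : IsClosed (Set.range fun v : A.domain => A v - z • (v : H)) := by
  have : CompleteSpace A.graph := hc.completeSpace_coe
  let L : A.graph →L[ℂ] H :=
    (ContinuousLinearMap.snd ℂ H H - z • ContinuousLinearMap.fst ℂ H H) ∘L A.graph.subtypeL
  have hL : ∀ p : A.graph, ‖p‖ ≤ (|z.im|⁻¹ + 1 + ‖z‖ * |z.im|⁻¹) * ‖L p‖ := by
    rintro ⟨⟨v, w⟩, hp⟩
    obtain ⟨v, rfl, rfl⟩ := A.mem_graph_iff.1 hp
    have hLp : L ⟨((v : H), A v), hp⟩ = A v - z • (v : H) := rfl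
    have h1 : ‖(v : H)‖ ≤ |z.im|⁻¹ * ‖A v - z • (v : H)‖ :=
      (le_inv_mul_iff₀ (abs_pos.2 hz)).2 (LinearPMap.IsFormalAdjoint.abs_im_mul_norm_le hs z v)
    have h2 : ‖A v‖ ≤ ‖A v - z • (v : H)‖ + ‖z‖ * ‖(v : H)‖ := by
      rw [← norm_smul]
      simpa using norm_add_le (A v - z • (v : H)) (z • (v : H))
    have h3 : ‖z‖ * ‖(v : H)‖ ≤ ‖z‖ * (|z.im|⁻¹ * ‖A v - z • (v : H)‖) := by gcongr
    have h4 : 0 ≤ ‖z‖ * (|z.im|⁻¹ * ‖A v - z • (v : H)‖) := by positivity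
    have h5 : 0 ≤ |z.im|⁻¹ * ‖A v - z • (v : H)‖ := by positivity
    have h6 := norm_nonneg (A v - z • (v : H))
    rw [hLp]
    change max ‖(v : H)‖ ‖A v‖ ≤ _
    apply max_le <;> linarith
  have hcl := (ContinuousLinearMap.antilipschitz_of_bound (K := Real.toNNReal
    (|z.im|⁻¹ + 1 + ‖z‖ * |z.im|⁻¹)) L fun p => by
      rw [Real.coe_toNNReal _ (by positivity)]
      exact hL p).isClosed_range L.uniformContinuous
  convert hcl using 1
  ext y
  constructor
  · rintro ⟨v, rfl⟩
    exact ⟨⟨(v, A v), A.mem_graph v⟩, rfl⟩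
  · rintro ⟨⟨⟨v, w⟩, hp⟩, rfl⟩
    obtain ⟨v, rfl, rfl⟩ := A.mem_graph_iff.1 hp
    exact ⟨v, rfl⟩

/-- If `A† - z` were injective, then `A - z̄` would be onto, so that
`D(A†) = D(A) + ker (A† - z̄)`. On this sum the boundary form `Im (Γ₁ x * conj (Γ₀ x))` has a
constant sign, while surjectivity of `(Γ₀, Γ₁)` provides both signs. -/
theorem exists_ne_zero_adjoint_eq_smul (Γ : BoundaryTriplet A) (hd : Dense (A.domain : Set H))
    (hc : A.IsClosed) (hs : IsSymmetricOp A) {z : ℂ} (hz : z.im ≠ 0) :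
    ∃ n : A†.domain, (n : H) ≠ 0 ∧ A† n - z • (n : H) = 0 := by
  by_contra! hcon
  have hz' : (conj z).im ≠ 0 := by simpa using hz
  let S : A.domain →ₗ[ℂ] H := A.toFun - conj z • A.domain.subtype
  have hS : ∀ v : A.domain, S v = A v - conj z • (v : H) := fun v => rfl
  have hclosed : IsClosed (S.range : Set H) := by
    rw [LinearMap.coe_range]
    exact isClosed_range_sub_smul hc hs hz'
  have htop : S.range = ⊤ := by
    rw [← hclosed.submodule_topologicalClosure_eq, Submodule.topologicalClosure_eq_top_iff,
      Submodule.eq_bot_iff]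
    intro y hy
    by_contra hne
    have hyv : ∀ v : A.domain, inner ℂ (z • y) (v : H) = inner ℂ y (A v) := by
      intro v
      have := (Submodule.mem_orthogonal' _ _).1 hy (S v) ⟨v, rfl⟩
      rw [hS, inner_sub_right, inner_smul_right, sub_eq_zero] at this
      rw [inner_smul_left, this]
    refine hcon ⟨y, LinearPMap.mem_adjoint_domain_of_exists y ⟨_, hyv⟩⟩ hne ?_
    rw [LinearPMap.adjoint_apply_eq hd _ hyv, sub_self]
  -- These boundary values give the form at `g` the sign of `Im z`, while on `ker (A† - z̄)` it has
  -- the sign of `Im z̄ = -Im z`.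
  obtain ⟨g, hg⟩ := Γ.surjective (1, Complex.I * z.im)
  simp only [Prod.mk.injEq] at hg
  obtain ⟨a, ha⟩ : A† g - conj z • (g : H) ∈ S.range := htop ▸ Submodule.mem_top
  obtain ⟨ha', haA⟩ := mem_domain_adjoint hd hs a
  obtain ⟨h0, h1⟩ := Γ.apply_eq_zero hd hs ⟨a, ha'⟩ a.2
  set n : A†.domain := g - ⟨a, ha'⟩ with hn
  have hn0 : Γ.Γ₀ n = 1 := by rw [hn, map_sub, h0, hg.1, sub_zero]
  have hn1 : Γ.Γ₁ n = Complex.I * z.im := by rw [hn, map_sub, h1, hg.2, sub_zero]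
  have hnA : A† n = conj z • (n : H) := by
    rw [hn, LinearPMap.map_sub, haA, Submodule.coe_sub, smul_sub]
    rw [hS] at ha
    rw [sub_eq_sub_iff_add_eq_add] at ha
    rw [sub_eq_sub_iff_add_eq_add, ← ha, add_comm]
  have hgr := Γ.green n n
  rw [hnA, hn0, hn1, inner_smul_right, inner_smul_left, inner_self_eq_norm_sq_to_K] at hgr
  have him := congrArg Complex.im hgr
  simp [← Complex.ofReal_pow] at him
  have hsq := sq_nonneg ‖(n : H)‖
  have h3 : -‖(n : H)‖ ^ 2 = 1 := by
    refine mul_left_cancel₀ (mul_ne_zero two_ne_zero hz) ?_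
    linarith
  linarith

end BoundaryTriplet

/-! ### Coupling a boundary triplet with a boundary relation -/

/-- A linear relation `S u u' c e` between elements `u, u'` of a Hilbert space `F` and boundary
values `c, e`, which behaves like (the graph of) the adjoint of a simple symmetric operator
`u ↦ u'` with boundary maps `c, e` and Weyl function `φ`:
it satisfies an abstract Green identity, `u' - z u = w` is solvable with `c = 0` for nonreal `z`,
there are defect elements with `c = 1` and `e = φ z`, and these span a dense subspace. -/
structure IsBoundaryRelation {F : Type*} [NormedAddCommGroup F] [InnerProductSpace ℂ F]
    (S : F → F → ℂ → ℂ → Prop) (φ : ℂ → ℂ) : Prop where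
  add : ∀ {u u' c e v v' d k}, S u u' c e → S v v' d k → S (u + v) (u' + v') (c + d) (e + k)
  smul : ∀ (a : ℂ) {u u' c e}, S u u' c e → S (a • u) (a • u') (a * c) (a * e)
  green : ∀ {u u' c e v v' d k}, S u u' c e → S v v' d k →
    inner ℂ v u' - inner ℂ v' u = e * conj d - c * conj k
  solvable : ∀ z : ℂ, z.im ≠ 0 → ∀ w : F, ∃ u e, S u (w + z • u) 0 e
  defect : ∀ z : ℂ, z.im ≠ 0 → ∃ γ, S γ (z • γ) 1 (φ z)
  simple : ∀ u : F, (∀ z : ℂ, z.im ≠ 0 → ∀ γ, S γ (z • γ) 1 (φ z) → inner ℂ γ u = 0) → u = 0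

/-- `T` is the operator in `H ⊕ F` that couples `A†` with the relation `S` by the interface
conditions `c = Γ₀ x` and `e = -Γ₁ x`. -/
def IsCoupling {H : Type*} [NormedAddCommGroup H] [InnerProductSpace ℂ H] [CompleteSpace H]
    {A : H →ₗ.[ℂ] H} (Γ : BoundaryTriplet A)
    {F : Type*} [NormedAddCommGroup F] [InnerProductSpace ℂ F]
    (S : F → F → ℂ → ℂ → Prop) (T : WithLp 2 (H × F) →ₗ.[ℂ] WithLp 2 (H × F)) : Prop :=
  ∀ x y : WithLp 2 (H × F), (∃ h : x ∈ T.domain, T ⟨x, h⟩ = y) ↔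
    ∃ hx : x.fst ∈ A†.domain, A† ⟨x.fst, hx⟩ = y.fst ∧
      S x.snd y.snd (Γ.Γ₀ ⟨x.fst, hx⟩) (-Γ.Γ₁ ⟨x.fst, hx⟩)

section Coupling

theorem inclFst_apply {H F : Type*} [NormedAddCommGroup H] [InnerProductSpace ℂ H]
    [NormedAddCommGroup F] [InnerProductSpace ℂ F] (x : H) :
    inclFst H F x = WithLp.toLp 2 (x, (0 : F)) := rfl

variable {H : Type*} [NormedAddCommGroup H] [InnerProductSpace ℂ H] [CompleteSpace H]
  {A : H →ₗ.[ℂ] H} {Γ : BoundaryTriplet A}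
  {F : Type*} [NormedAddCommGroup F] [InnerProductSpace ℂ F]
  {S : F → F → ℂ → ℂ → Prop} {φ : ℂ → ℂ} {T : WithLp 2 (H × F) →ₗ.[ℂ] WithLp 2 (H × F)}

/-- The orthogonal projection of `H ⊕ F` onto `H` is the first coordinate. -/
theorem adjoint_inclFst_apply [CompleteSpace F] (k : WithLp 2 (H × F)) :
    ContinuousLinearMap.adjoint (inclFst H F).toContinuousLinearMap k = k.fst := by
  refine ext_inner_right ℂ fun x => ?_
  rw [ContinuousLinearMap.adjoint_inner_left]
  change inner ℂ k (WithLp.toLp 2 (x, (0 : F))) = _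
  simp [WithLp.prod_inner_apply]

namespace IsCoupling

/-- The two Green identities add up to symmetry of the coupled operator. -/
theorem isFormalAdjoint (hT : IsCoupling Γ S T) (hS : IsBoundaryRelation S φ) :
    T.IsFormalAdjoint T := by
  intro y x
  obtain ⟨hx, hxA, hxS⟩ := (hT x (T x)).1 ⟨x.2, rfl⟩
  obtain ⟨hy, hyA, hyS⟩ := (hT y (T y)).1 ⟨y.2, rfl⟩
  have h1 := Γ.green ⟨_, hx⟩ ⟨_, hy⟩
  have h2 := hS.green hxS hyS
  rw [hxA, hyA] at h1
  rw [map_neg] at h2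
  simp only [WithLp.prod_inner_apply]
  change inner ℂ (T y).fst (x : WithLp 2 (H × F)).fst
      + inner ℂ (T y).snd (x : WithLp 2 (H × F)).snd
    = inner ℂ (y : WithLp 2 (H × F)).fst (T x).fst + inner ℂ (y : WithLp 2 (H × F)).snd (T x).snd
  linear_combination -h1 - h2

/-- A solution `y` of the boundary value problem, completed by the multiple `Γ₀ y • γ` of the defect
element, solves `(T - z) (y, Γ₀ y • γ) = (x, 0)`. -/
theorem apply_defect (hT : IsCoupling Γ S T) (hS : IsBoundaryRelation S φ) {z : ℂ} {x : H} {γ : F}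
    (hγ : S γ (z • γ) 1 (φ z)) (y : A†.domain) (hy : A† y - z • (y : H) = x)
    (hb : Γ.Γ₁ y + φ z * Γ.Γ₀ y = 0) :
    ∃ h : WithLp.toLp 2 ((y : H), Γ.Γ₀ y • γ) ∈ T.domain,
      T ⟨_, h⟩ - z • WithLp.toLp 2 ((y : H), Γ.Γ₀ y • γ) = inclFst H F x := by
  obtain ⟨h, hTy⟩ := (hT (WithLp.toLp 2 ((y : H), Γ.Γ₀ y • γ))
    (inclFst H F x + z • WithLp.toLp 2 ((y : H), Γ.Γ₀ y • γ))).2 ⟨y.2, by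
      change A† y = x + z • (y : H)
      rw [← hy, sub_add_cancel], by
      change S (Γ.Γ₀ y • γ) (0 + z • Γ.Γ₀ y • γ) (Γ.Γ₀ y) (-Γ.Γ₁ y)
      have h := hS.smul (Γ.Γ₀ y) hγ
      rw [mul_one, smul_comm] at h
      rw [zero_add]
      convert h using 1
      linear_combination -hb⟩
  exact ⟨h, by rw [hTy, add_sub_cancel_right]⟩

/-- The homogeneous boundary value problem has only the zero solution, because `T` has no nonreal
eigenvalues. -/
theorem eq_zero_of_boundary (hT : IsCoupling Γ S T) (hS : IsBoundaryRelation S φ) {z : ℂ}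
    (hz : z.im ≠ 0) (y : A†.domain) (hy : A† y - z • (y : H) = 0)
    (hb : Γ.Γ₁ y + φ z * Γ.Γ₀ y = 0) : (y : H) = 0 := by
  obtain ⟨γ, hγ⟩ := hS.defect z hz
  obtain ⟨h, hTy⟩ := hT.apply_defect hS hγ y hy hb
  have := (hT.isFormalAdjoint hS).eq_zero_of_apply_eq_smul hz ⟨_, h⟩ (by rw [hTy, map_zero])
  exact congrArg WithLp.fst this

/-- The boundary value problem `A† y - z y = x`, `Γ₁ y + φ z * Γ₀ y = b` is solvable: correct any
solution of the first equation by a multiple of a nonzero defect element, on which the second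
functional does not vanish. -/
theorem exists_boundary (hT : IsCoupling Γ S T) (hS : IsBoundaryRelation S φ)
    (hd : Dense (A.domain : Set H)) (hc : A.IsClosed) (hs : IsSymmetricOp A) {z : ℂ}
    (hz : z.im ≠ 0) (x : H) (b : ℂ) :
    ∃ y : A†.domain, A† y - z • (y : H) = x ∧ Γ.Γ₁ y + φ z * Γ.Γ₀ y = b := by
  obtain ⟨y, hy⟩ := BoundaryTriplet.exists_adjoint_sub_smul_eq hd hs hz x
  obtain ⟨n, hn, hnA⟩ := Γ.exists_ne_zero_adjoint_eq_smul hd hc hs hz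
  have hne : Γ.Γ₁ n + φ z * Γ.Γ₀ n ≠ 0 := fun h => hn (hT.eq_zero_of_boundary hS hz n hnA h)
  set a := (b - (Γ.Γ₁ y + φ z * Γ.Γ₀ y)) / (Γ.Γ₁ n + φ z * Γ.Γ₀ n) with ha
  have ha' : a * (Γ.Γ₁ n + φ z * Γ.Γ₀ n) = b - (Γ.Γ₁ y + φ z * Γ.Γ₀ y) := div_mul_cancel₀ _ hne
  refine ⟨y + a • n, ?_, ?_⟩
  · rw [LinearPMap.map_add, LinearPMap.map_smul, Submodule.coe_add, Submodule.coe_smul, smul_add,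
      smul_comm z a, add_sub_add_comm, ← smul_sub, hy, hnA, smul_zero, add_zero]
  · rw [map_add, map_add, map_smul, map_smul, smul_eq_mul, smul_eq_mul]
    linear_combination ha'

/-- To solve `(T - z) (y, v) = w`, take `v = u + Γ₀ y • γ` with `u` a solution in `F` with `c = 0` and
`γ` a defect element; the interface condition becomes a boundary value problem for `y`. -/
theorem isSymmetricOnto (hT : IsCoupling Γ S T) (hS : IsBoundaryRelation S φ)
    (hd : Dense (A.domain : Set H)) (hc : A.IsClosed) (hs : IsSymmetricOp A) :
    IsSymmetricOnto T := by
  refine ⟨hT.isFormalAdjoint hS, fun z hz w => ?_⟩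
  obtain ⟨u, e, hu⟩ := hS.solvable z hz w.snd
  obtain ⟨γ, hγ⟩ := hS.defect z hz
  obtain ⟨y, hy, hb⟩ := hT.exists_boundary hS hd hc hs hz w.fst (-e)
  obtain ⟨h, hTy⟩ := (hT (WithLp.toLp 2 ((y : H), u + Γ.Γ₀ y • γ))
    (w + z • WithLp.toLp 2 ((y : H), u + Γ.Γ₀ y • γ))).2 ⟨y.2, by
      change A† y = w.fst + z • (y : H)
      rw [← hy, sub_add_cancel], by
      change S (u + Γ.Γ₀ y • γ) (w.snd + z • (u + Γ.Γ₀ y • γ)) (Γ.Γ₀ y) (-Γ.Γ₁ y)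
      have h := hS.add hu (hS.smul (Γ.Γ₀ y) hγ)
      rw [mul_one, zero_add, smul_comm, add_assoc, ← smul_add] at h
      convert h using 1
      linear_combination -hb⟩
  exact ⟨⟨_, h⟩, by rw [hTy, add_sub_cancel_right]⟩

/-- A vector orthogonal to all `(T - z)⁻¹ x`, `x ∈ H`, has `(T - z)⁻¹ v ∈ 0 ⊕ F`; there both
boundary values vanish, so the `H`-component of `v` is zero and its `F`-component is orthogonal to
all defect elements. -/
theorem resolventSpan_eq_top [CompleteSpace F] (hT : IsCoupling Γ S T)
    (hS : IsBoundaryRelation S φ)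
    (hd : Dense (A.domain : Set H)) (hc : A.IsClosed) (hs : IsSymmetricOp A) :
    resolventSpan (inclFst H F) T = ⊤ := by
  have hso := hT.isSymmetricOnto hS hd hc hs
  rw [resolventSpan, Submodule.topologicalClosure_eq_top_iff, Submodule.eq_bot_iff]
  intro v hv
  have key : ∀ z : ℂ, z.im ≠ 0 → v.fst = 0 ∧ ∃ u, S u (v.snd + z • u) 0 0 := by
    intro z hz
    have hz' : (conj z).im ≠ 0 := by simpa using hz
    obtain ⟨h, hTv⟩ := (hso.isResolventAt hz).1 v
    set k := resolventOp T z v with hk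
    have hk0 : k.fst = 0 := by
      refine ext_inner_left ℂ fun x => ?_
      have h1 := (Submodule.mem_orthogonal _ _).1 hv _
        (Submodule.subset_span ⟨x, conj z, hz', rfl⟩)
      rw [hso.inner_resolventOp hz', Complex.conj_conj, ← hk, inclFst_apply,
        WithLp.prod_inner_apply] at h1
      simpa using h1
    obtain ⟨hx, hA, hSk⟩ := (hT k (v + z • k)).1 ⟨h, sub_eq_iff_eq_add.1 hTv⟩
    have h0 : (⟨k.fst, hx⟩ : A†.domain) = 0 := Subtype.ext hk0
    rw [h0, map_zero, map_zero, neg_zero] at hSk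
    rw [h0, LinearPMap.map_zero, WithLp.add_fst, WithLp.smul_fst, hk0, smul_zero, add_zero] at hA
    exact ⟨hA.symm, k.snd, hSk⟩
  have hsnd : v.snd = 0 := by
    refine hS.simple _ fun z hz γ hγ => ?_
    obtain ⟨-, u, hu⟩ := key (conj z) (by simpa using hz)
    have h := hS.green hu hγ
    rw [inner_add_right, inner_smul_right, inner_smul_left] at h
    linear_combination h
  exact (WithLp.ext_iff 2).2 <| Prod.ext (key Complex.I (by simp)).1 hsnd

/-- The abstract coupling theorem: the coupled operator is a minimal self-adjoint extension, and
its compressed resolvent solves the boundary value problem with `φ = f`. -/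
theorem isMinimalExtensionFor [CompleteSpace F] {f : ℂ → ℂ} (hT : IsCoupling Γ S T)
    (hS : IsBoundaryRelation S (symmExtend f))
    (hd : Dense (A.domain : Set H)) (hc : A.IsClosed) (hs : IsSymmetricOp A) :
    IsMinimalExtensionFor Γ f (inclFst H F) T := by
  have hso := hT.isSymmetricOnto hS hd hc hs
  have hspan := hT.resolventSpan_eq_top hS hd hc hs
  have hcomp : ∀ z x, compressedResolvent (inclFst H F) T z x
      = (resolventOp T z (inclFst H F x)).fst := fun z x => adjoint_inclFst_apply _
  have hsolve : ∀ z : ℂ, z.im ≠ 0 → ∀ (x : H) (y : A†.domain), A† y - z • (y : H) = x →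
      Γ.Γ₁ y + symmExtend f z * Γ.Γ₀ y = 0 → compressedResolvent (inclFst H F) T z x = y := by
    intro z hz x y hy hb
    obtain ⟨γ, hγ⟩ := hS.defect z hz
    obtain ⟨h, hTy⟩ := hT.apply_defect hS hγ y hy hb
    rw [hcomp, ← hTy]
    exact congrArg WithLp.fst ((hso.isResolventAt hz).2 ⟨_, h⟩)
  refine ⟨⟨hso.dense_domain, hso.adjoint_eq, fun a => ?_⟩, hso.isMinimalExtension _ hspan, hspan,
    fun z hz => hso.isResolventAt hz, ⟨?_, fun z hz x y => ⟨?_, ?_⟩⟩⟩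
  · obtain ⟨ha, haA⟩ := BoundaryTriplet.mem_domain_adjoint hd hs a
    obtain ⟨h0, h1⟩ := Γ.apply_eq_zero hd hs ⟨a, ha⟩ a.2
    refine (hT _ _).2 ⟨ha, haA, ?_⟩
    change S 0 0 (Γ.Γ₀ ⟨a, ha⟩) (-Γ.Γ₁ ⟨a, ha⟩)
    obtain ⟨γ, hγ⟩ := hS.defect Complex.I (by simp)
    have h := hS.smul 0 hγ
    rw [h0, h1, neg_zero]
    simpa using h
  · intro z hz
    exact (differentiableWithinAt_const _).clm_comp
      ((hso.differentiableOn_resolventOp z hz).clm_comp (differentiableWithinAt_const _))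
  · rintro rfl
    obtain ⟨y, hy, hb⟩ := hT.exists_boundary hS hd hc hs hz x 0
    rw [hsolve z hz x y hy hb]
    exact ⟨y.2, hy, hb⟩
  · rintro ⟨hy, hyA, hb⟩
    exact hsolve z hz x ⟨y, hy⟩ hyA hb

end IsCoupling

end Coupling

/-! ### Completeness of the Cauchy kernels -/

section CauchyKernel

theorem Complex.abs_im_le_norm_ofReal_sub (t : ℝ) (z : ℂ) : |z.im| ≤ ‖(t : ℂ) - z‖ := by
  simpa using Complex.abs_im_le_norm ((t : ℂ) - z)

theorem Complex.ofReal_sub_ne_zero {z : ℂ} (hz : z.im ≠ 0) (t : ℝ) : (t : ℂ) - z ≠ 0 :=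
  norm_pos_iff.1 ((abs_pos.2 hz).trans_le (Complex.abs_im_le_norm_ofReal_sub t z))

theorem Complex.norm_inv_ofReal_sub_le {z : ℂ} (hz : z.im ≠ 0) (t : ℝ) :
    ‖((t : ℂ) - z)⁻¹‖ ≤ |z.im|⁻¹ := by
  rw [norm_inv]
  exact inv_anti₀ (abs_pos.2 hz) (Complex.abs_im_le_norm_ofReal_sub t z)

theorem Complex.norm_inv_ofReal_sub_le_mul {z w : ℂ} (hz : z.im ≠ 0) (hw : w.im ≠ 0) (t : ℝ) :
    ‖((t : ℂ) - z)⁻¹‖ ≤ (1 + |z.im|⁻¹ * ‖z - w‖) * ‖((t : ℂ) - w)⁻¹‖ := by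
  have h1 := Complex.ofReal_sub_ne_zero hz t
  have h2 := Complex.ofReal_sub_ne_zero hw t
  have h : ((t : ℂ) - z)⁻¹ = (1 + ((t : ℂ) - z)⁻¹ * (z - w)) * ((t : ℂ) - w)⁻¹ := by
    field_simp
    ring
  calc ‖((t : ℂ) - z)⁻¹‖ = ‖1 + ((t : ℂ) - z)⁻¹ * (z - w)‖ * ‖((t : ℂ) - w)⁻¹‖ := by
        rw [← norm_mul, ← h]
    _ ≤ _ := by
      gcongr
      refine (norm_add_le _ _).trans ?_
      rw [norm_one, norm_mul]
      gcongr
      exact Complex.norm_inv_ofReal_sub_le hz t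

theorem Complex.measurable_inv_ofReal_sub (z : ℂ) : Measurable fun t : ℝ => ((t : ℂ) - z)⁻¹ := by
  fun_prop

theorem Complex.continuous_inv_ofReal_sub {z : ℂ} (hz : z.im ≠ 0) :
    Continuous fun t : ℝ => ((t : ℂ) - z)⁻¹ :=
  (by fun_prop : Continuous fun t : ℝ => (t : ℂ) - z).inv₀ (Complex.ofReal_sub_ne_zero hz)

variable {σ : Measure ℝ} {g : ℝ → ℂ}

/-- The condition on `g` in this and the following lemmas, integrability of `g / (t - i)`, holds for
`g ∈ L²(σ)` when `∫ dσ / (1 + t²) < ∞`. -/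
theorem integrable_mul_of_norm_le_inv (hm : AEStronglyMeasurable g σ)
    (hg : Integrable (fun t : ℝ => g t * ((t : ℂ) - Complex.I)⁻¹) σ) {k : ℝ → ℂ}
    (hk : Measurable k) {C : ℝ} (hC : ∀ t, ‖k t‖ ≤ C * ‖((t : ℂ) - Complex.I)⁻¹‖) :
    Integrable (fun t => g t * k t) σ := by
  refine (hg.norm.const_mul C).mono' (hm.mul hk.aestronglyMeasurable)
    (Filter.Eventually.of_forall fun t => ?_)
  rw [norm_mul, norm_mul, mul_left_comm]
  exact mul_le_mul_of_nonneg_left (hC t) (norm_nonneg _)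

theorem integrable_mul_inv_pow (hm : AEStronglyMeasurable g σ)
    (hg : Integrable (fun t : ℝ => g t * ((t : ℂ) - Complex.I)⁻¹) σ) {z w : ℂ} (hz : z.im ≠ 0)
    (hw : w.im ≠ 0) (a b : ℕ) (hab : a + b ≠ 0) :
    Integrable (fun t : ℝ => g t * (((t : ℂ) - z)⁻¹ ^ a * ((t : ℂ) - w)⁻¹ ^ b)) σ := by
  have hI : Complex.I.im ≠ 0 := by simp
  rcases a with _ | a
  · rcases b with _ | b
    · simp at hab
    refine integrable_mul_of_norm_le_inv hm hg (by fun_prop)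
      (C := |w.im|⁻¹ ^ b * (1 + |w.im|⁻¹ * ‖w - Complex.I‖)) fun t => ?_
    rw [pow_zero, one_mul, norm_pow, pow_succ, mul_assoc]
    gcongr
    · exact Complex.norm_inv_ofReal_sub_le hw t
    · exact Complex.norm_inv_ofReal_sub_le_mul hw hI t
  · refine integrable_mul_of_norm_le_inv hm hg (by fun_prop)
      (C := |z.im|⁻¹ ^ a * |w.im|⁻¹ ^ b * (1 + |z.im|⁻¹ * ‖z - Complex.I‖)) fun t => ?_
    rw [pow_succ, mul_right_comm, norm_mul, norm_mul, norm_pow, norm_pow, mul_assoc _ (1 + _)]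
    gcongr
    · exact Complex.norm_inv_ofReal_sub_le hz t
    · exact Complex.norm_inv_ofReal_sub_le hw t
    · exact Complex.norm_inv_ofReal_sub_le_mul hz hI t

/-- If the Cauchy transform of `g` vanishes, so do all its derivatives, computed under the integral
sign. -/
theorem integral_mul_inv_pow_eq_zero (hm : AEStronglyMeasurable g σ)
    (hg : Integrable (fun t : ℝ => g t * ((t : ℂ) - Complex.I)⁻¹) σ)
    (h0 : ∀ z : ℂ, z.im ≠ 0 → ∫ t : ℝ, g t * ((t : ℂ) - z)⁻¹ ∂σ = 0) (n : ℕ) :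
    ∀ z : ℂ, z.im ≠ 0 → ∫ t : ℝ, g t * ((t : ℂ) - z)⁻¹ ^ (n + 1) ∂σ = 0 := by
  have hint : ∀ z : ℂ, z.im ≠ 0 → ∀ k : ℕ,
      Integrable (fun t : ℝ => g t * ((t : ℂ) - z)⁻¹ ^ (k + 1)) σ := fun z hz k => by
    simpa using integrable_mul_inv_pow hm hg hz hz (k + 1) 0 (by simp)
  induction n with
  | zero => simpa using h0
  | succ n ih =>
    intro z hz
    have hr : 0 < |z.im| / 2 := half_pos (abs_pos.2 hz)
    have him : ∀ w ∈ Metric.ball z (|z.im| / 2), w.im ≠ 0 := by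
      intro w hw h
      have := (Complex.abs_im_le_norm (w - z)).trans_lt (mem_ball_iff_norm.1 hw)
      rw [Complex.sub_im, h, zero_sub, abs_neg] at this
      linarith
    -- On this ball `‖(t - w)⁻¹‖ ≤ 2 ‖(t - z)⁻¹‖`.
    have hle : ∀ w ∈ Metric.ball z (|z.im| / 2), ∀ t : ℝ,
        ‖((t : ℂ) - w)⁻¹‖ ≤ 2 * ‖((t : ℂ) - z)⁻¹‖ := by
      intro w hw t
      have h1 := Complex.abs_im_le_norm_ofReal_sub t z
      have h2 : ‖(t : ℂ) - z‖ ≤ ‖(t : ℂ) - w‖ + ‖w - z‖ := by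
        simpa using norm_add_le ((t : ℂ) - w) (w - z)
      have h3 := mem_ball_iff_norm.1 hw
      have h4 : 0 < ‖(t : ℂ) - z‖ := by linarith
      rw [norm_inv, norm_inv, ← div_eq_mul_inv, le_div_iff₀ h4, inv_mul_le_iff₀ (by linarith)]
      linarith
    have hder := (hasDerivAt_integral_of_dominated_loc_of_deriv_le (μ := σ) (x₀ := z)
      (s := Metric.ball z (|z.im| / 2))
      (bound := fun t : ℝ => (n + 1) * 2 ^ (n + 2) * ‖g t * ((t : ℂ) - z)⁻¹ ^ (n + 2)‖)
      (F := fun w t => g t * ((t : ℂ) - w)⁻¹ ^ (n + 1))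
      (F' := fun w t => (n + 1) * (g t * ((t : ℂ) - w)⁻¹ ^ (n + 2)))
      (Metric.ball_mem_nhds z hr)
      (Filter.Eventually.of_forall fun w =>
        hm.mul (by fun_prop : Measurable _).aestronglyMeasurable)
      (hint z hz n)
      ((hint z hz (n + 1)).const_mul _).aestronglyMeasurable
      (Filter.Eventually.of_forall fun t w hw => by
        have hn : ‖(n + 1 : ℂ)‖ = n + 1 := by exact_mod_cast Complex.norm_natCast (n + 1)
        rw [norm_mul, norm_mul, norm_mul, hn, norm_pow, norm_pow, mul_assoc, mul_left_comm (2 ^ _),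
          ← mul_pow]
        gcongr
        exact hle w hw t)
      (((hint z hz (n + 1)).norm).const_mul _)
      (Filter.Eventually.of_forall fun t w hw => by
        have hne := Complex.ofReal_sub_ne_zero (him w hw) t
        have h := ((((hasDerivAt_id w).const_sub (t : ℂ)).inv hne).pow (n + 1)).const_mul (g t)
        refine h.congr_deriv ?_
        have hsq : (1 : ℂ) / ((t : ℂ) - w) ^ 2 = ((t : ℂ) - w)⁻¹ ^ 2 := by rw [inv_pow, one_div]
        simp only [Pi.inv_apply, id_eq, Nat.add_sub_cancel, neg_neg, hsq]
        push_cast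
        ring)).2
    have hzero : (fun w => ∫ t : ℝ, g t * ((t : ℂ) - w)⁻¹ ^ (n + 1) ∂σ) =ᶠ[nhds z] fun _ => 0 := by
      filter_upwards [Metric.ball_mem_nhds z hr] with w hw
      exact ih w (him w hw)
    have h := (hder.congr_of_eventuallyEq hzero.symm).unique (hasDerivAt_const z (0 : ℂ))
    rw [integral_const_mul] at h
    exact (mul_eq_zero.1 h).resolve_left (by exact_mod_cast n.succ_ne_zero)

/-- Partial fractions: the mixed powers are combinations of the pure ones. -/
theorem integral_mul_inv_pow_mul_inv_pow_eq_zero (hm : AEStronglyMeasurable g σ)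
    (hg : Integrable (fun t : ℝ => g t * ((t : ℂ) - Complex.I)⁻¹) σ)
    (h0 : ∀ z : ℂ, z.im ≠ 0 → ∫ t : ℝ, g t * ((t : ℂ) - z)⁻¹ ∂σ = 0) (a b : ℕ) (hab : a + b ≠ 0) :
    ∫ t : ℝ, g t * (((t : ℂ) - Complex.I)⁻¹ ^ a * ((t : ℂ) - -Complex.I)⁻¹ ^ b) ∂σ = 0 := by
  have hI : Complex.I.im ≠ 0 := by simp
  have hI' : (-Complex.I).im ≠ 0 := by simp
  induction a generalizing b with
  | zero =>
    rcases b with _ | b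
    · simp at hab
    · simpa using integral_mul_inv_pow_eq_zero hm hg h0 b _ hI'
  | succ a iha =>
    induction b with
    | zero => simpa using integral_mul_inv_pow_eq_zero hm hg h0 a _ hI
    | succ b ihb =>
      have h1 := iha (b + 1) (by simp)
      have h2 := ihb (by simp)
      have hsplit : ∀ t : ℝ,
          g t * (((t : ℂ) - Complex.I)⁻¹ ^ (a + 1) * ((t : ℂ) - -Complex.I)⁻¹ ^ (b + 1))
            = (2 * Complex.I)⁻¹ *
              (g t * (((t : ℂ) - Complex.I)⁻¹ ^ (a + 1) * ((t : ℂ) - -Complex.I)⁻¹ ^ b)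
                - g t * (((t : ℂ) - Complex.I)⁻¹ ^ a * ((t : ℂ) - -Complex.I)⁻¹ ^ (b + 1))) := by
        intro t
        have e1 := Complex.ofReal_sub_ne_zero hI t
        have e2 := Complex.ofReal_sub_ne_zero hI' t
        have e3 : ((t : ℂ) - Complex.I)⁻¹ * ((t : ℂ) - -Complex.I)⁻¹
            = (2 * Complex.I)⁻¹ * (((t : ℂ) - Complex.I)⁻¹ - ((t : ℂ) - -Complex.I)⁻¹) := by
          field_simp
          ring
        rw [pow_succ, pow_succ]
        linear_combination g t * ((t : ℂ) - Complex.I)⁻¹ ^ a * ((t : ℂ) - -Complex.I)⁻¹ ^ b * e3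
      simp_rw [hsplit]
      rw [integral_const_mul, integral_sub
        (integrable_mul_inv_pow hm hg hI hI' _ _ (by simp))
        (integrable_mul_inv_pow hm hg hI hI' _ _ (by simp)), h1, h2, sub_zero, mul_zero]

/-- A continuous function on the one-point compactification of `ℝ`, from its limit at infinity. -/
noncomputable def onePointExtension (k : C(ℝ, ℂ))
    (hk : Filter.Tendsto k (Filter.cocompact ℝ) (nhds 0)) : C(OnePoint ℝ, ℂ) :=
  OnePoint.continuousMapMk k 0 (by rwa [Filter.coclosedCompact_eq_cocompact])

/-- **Uniqueness of the Cauchy transform.** The functions `1 / (t ± i)` generate a dense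
star-subalgebra of the continuous functions on the one-point compactification of `ℝ`. -/
theorem ae_eq_zero_of_integral_mul_inv_eq_zero (hm : AEStronglyMeasurable g σ)
    (hg : Integrable (fun t : ℝ => g t * ((t : ℂ) - Complex.I)⁻¹) σ)
    (h0 : ∀ z : ℂ, z.im ≠ 0 → ∫ t : ℝ, g t * ((t : ℂ) - z)⁻¹ ∂σ = 0) : g =ᵐ[σ] 0 := by
  have hI : Complex.I.im ≠ 0 := by simp
  have hlim : Filter.Tendsto (fun t : ℝ => ((t : ℂ) - Complex.I)⁻¹) (Filter.cocompact ℝ)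
      (nhds 0) := by
    refine Filter.tendsto_inv₀_cobounded.comp ?_
    rw [← tendsto_norm_atTop_iff_cobounded]
    refine Filter.tendsto_atTop_mono (f := fun t : ℝ => ‖t‖) (fun t => ?_)
      (tendsto_norm_cocompact_atTop)
    simpa using Complex.abs_re_le_norm ((t : ℂ) - Complex.I)
  let p : C(OnePoint ℝ, ℂ) := onePointExtension ⟨_, Complex.continuous_inv_ofReal_sub hI⟩ hlim
  have hp : ∀ t : ℝ, p (t : OnePoint ℝ) = ((t : ℂ) - Complex.I)⁻¹ := fun t => rfl
  have hp' : ∀ t : ℝ, star p (t : OnePoint ℝ) = ((t : ℂ) - -Complex.I)⁻¹ := fun t => by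
    rw [ContinuousMap.star_apply, hp]
    simp
  have hpinf : p OnePoint.infty = 0 := rfl
  let B := StarAlgebra.adjoin ℂ {p}
  have hsep : B.SeparatesPoints := by
    have hpinj : Function.Injective p := by
      intro x y hxy
      induction x using OnePoint.rec with
      | infty =>
        induction y using OnePoint.rec with
        | infty => rfl
        | coe y =>
          rw [hpinf, hp] at hxy
          exact absurd hxy.symm (inv_ne_zero (Complex.ofReal_sub_ne_zero hI y))
      | coe x =>
        induction y using OnePoint.rec with
        | infty =>
          rw [hpinf, hp] at hxy
          exact absurd hxy (inv_ne_zero (Complex.ofReal_sub_ne_zero hI x))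
        | coe y =>
          rw [hp, hp, inv_inj, sub_left_inj, Complex.ofReal_inj] at hxy
          rw [hxy]
    intro x y hxy
    exact ⟨p, ⟨p, StarAlgebra.self_mem_adjoin_singleton ℂ p, rfl⟩, hpinj.ne hxy⟩
  have hB := ContinuousMap.starSubalgebra_topologicalClosure_eq_top_of_separatesPoints B hsep
  -- The finite complex measure `k dσ` annihilates the subalgebra, hence all continuous functions.
  set k : ℝ → ℂ := fun t => g t * ((t : ℂ) - Complex.I)⁻¹ with hk
  have hkint : ∀ F : C(OnePoint ℝ, ℂ), Integrable (fun t : ℝ => F t * k t) σ := fun F =>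
    hg.bdd_mul (c := ‖F‖) (F.continuous.comp OnePoint.continuous_coe).aestronglyMeasurable
      (Filter.Eventually.of_forall fun t => F.norm_coe_le_norm t)
  let Λ : C(OnePoint ℝ, ℂ) →L[ℂ] ℂ := LinearMap.mkContinuous
    { toFun := fun F => ∫ t : ℝ, F t * k t ∂σ
      map_add' := fun F G => by
        simp only [ContinuousMap.add_apply, add_mul]
        exact integral_add (hkint F) (hkint G)
      map_smul' := fun c F => by
        simp only [ContinuousMap.smul_apply, smul_eq_mul, mul_assoc, RingHom.id_apply]
        exact integral_const_mul _ _ } (∫ t, ‖k t‖ ∂σ) (fun F => by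
      change ‖∫ t : ℝ, F t * k t ∂σ‖ ≤ _
      rw [mul_comm, ← integral_const_mul]
      refine norm_integral_le_of_norm_le (hg.norm.const_mul _)
        (Filter.Eventually.of_forall fun t => ?_)
      rw [norm_mul]
      gcongr
      exact F.norm_coe_le_norm t)
  have hΛ : ∀ F, Λ F = ∫ t : ℝ, F t * k t ∂σ := fun F => rfl
  -- The statement that is stable under multiplication by the two generators.
  have hmono : ∀ F ∈ Submonoid.closure ({p} ∪ star {p} : Set C(OnePoint ℝ, ℂ)), ∀ a b : ℕ,
      ∫ t : ℝ, F t * (g t * (((t : ℂ) - Complex.I)⁻¹ ^ (a + 1)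
        * ((t : ℂ) - -Complex.I)⁻¹ ^ b)) ∂σ = 0 := by
    intro F hF
    induction hF using Submonoid.closure_induction_left with
    | one =>
      intro a b
      simpa using integral_mul_inv_pow_mul_inv_pow_eq_zero hm hg h0 (a + 1) b (by simp)
    | mul_left q hq F hF ih =>
      intro a b
      rcases hq with hq | hq
      · rw [Set.mem_singleton_iff.1 hq, ← ih (a + 1) b]
        refine integral_congr_ae (Filter.Eventually.of_forall fun t => ?_)
        simp only [ContinuousMap.mul_apply, hp]
        ring
      · have hq' : q = star p := by
          rw [← star_star q, Set.mem_singleton_iff.1 (Set.mem_star.1 hq)]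
        rw [hq', ← ih a (b + 1)]
        refine integral_congr_ae (Filter.Eventually.of_forall fun t => ?_)
        simp only [ContinuousMap.mul_apply, hp']
        ring
  have hBker : (B : Set C(OnePoint ℝ, ℂ)) ⊆ Λ.ker := by
    intro F hF
    have hF' : F ∈ Submodule.span ℂ
        (Submonoid.closure ({p} ∪ star {p} : Set C(OnePoint ℝ, ℂ)) : Set C(OnePoint ℝ, ℂ)) := by
      rw [← StarAlgebra.adjoin_eq_span]
      exact hF
    refine (Submodule.span_le (p := Λ.ker)).2 ?_ hF'
    intro G hG
    change Λ G = 0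
    rw [hΛ]
    simpa [hk] using hmono G hG 0 0
  have hΛ0 : ∀ F, Λ F = 0 := by
    intro F
    have hF : F ∈ B.topologicalClosure := hB ▸ StarSubalgebra.mem_top
    exact closure_minimal hBker Λ.isClosed_ker hF
  have hk0 : ∀ᵐ t ∂σ, k t = 0 := by
    refine ae_eq_zero_of_integral_contDiff_smul_eq_zero hg.locallyIntegrable fun ψ hψ hψc => ?_
    have hψlim : Filter.Tendsto (fun t => ((ψ t : ℝ) : ℂ)) (Filter.cocompact ℝ) (nhds 0) := by
      have := (Complex.continuous_ofReal.tendsto 0).comp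
        (hψc.is_zero_at_infty)
      rw [Complex.ofReal_zero] at this
      exact this
    have h := hΛ0 (onePointExtension
      ⟨_, Complex.continuous_ofReal.comp hψ.continuous⟩ hψlim)
    rw [hΛ] at h
    simp_rw [Complex.real_smul]
    exact h
  filter_upwards [hk0] with t ht
  exact (mul_eq_zero.1 ht).resolve_right (inv_ne_zero (Complex.ofReal_sub_ne_zero hI t))

end CauchyKernel

/-! ### The boundary relation of a Nevanlinna function -/

namespace NevanlinnaData

variable (d : NevanlinnaData)

/-- The relation `u' = t u - c`, `e = h c + ∫ (u - t / (1 + t²) c) dσ` in `L²(σ)`. -/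
def Relation (u u' : d.L2) (c e : ℂ) : Prop :=
  (fun t : ℝ => (t : ℂ) * u t - c) =ᵐ[d.σ] u' ∧
    e = d.h * c + ∫ t : ℝ, (u t - (t : ℂ) / (1 + (t : ℂ) ^ 2) * c) ∂d.σ

variable {d} {u u' v v' : d.L2} {c e b k : ℂ}

/-- Membership of `t u - c` in `L²(σ)` is implicit in the a.e. equality with `u'`. -/
theorem relation_iff : d.Relation u u' c e ↔ ∃ h : (u, c) ∈ d.mulDomain,
    d.mulMap ⟨(u, c), h⟩ = u' ∧ e = d.h * c + d.intMap ⟨(u, c), h⟩ := by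
  constructor
  · rintro ⟨h, he⟩
    have hmem : (u, c) ∈ d.mulDomain := (memLp_congr_ae h).2 (Lp.memLp u')
    refine ⟨hmem, Lp.ext ?_, he⟩
    exact (MemLp.coeFn_toLp (d.memLp_of_mem ⟨(u, c), hmem⟩)).trans h
  · rintro ⟨h, rfl, he⟩
    exact ⟨(MemLp.coeFn_toLp (d.memLp_of_mem ⟨(u, c), h⟩)).symm, he⟩

theorem Relation.integrable (h : d.Relation u u' c e) :
    Integrable (fun t : ℝ => u t - (t : ℂ) / (1 + (t : ℂ) ^ 2) * c) d.σ := by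
  obtain ⟨hmem, -⟩ := relation_iff.1 h
  exact d.integrable_of_mem ⟨(u, c), hmem⟩

theorem Relation.add (hu : d.Relation u u' c e) (hv : d.Relation v v' b k) :
    d.Relation (u + v) (u' + v') (c + b) (e + k) := by
  constructor
  · filter_upwards [hu.1, hv.1, Lp.coeFn_add u v, Lp.coeFn_add u' v'] with t h1 h2 h3 h4
    rw [h3, h4, Pi.add_apply, Pi.add_apply, ← h1, ← h2]
    ring
  · have h : ∫ t : ℝ, ((u + v : d.L2) t - (t : ℂ) / (1 + (t : ℂ) ^ 2) * (c + b)) ∂d.σ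
        = ∫ t : ℝ, (u t - (t : ℂ) / (1 + (t : ℂ) ^ 2) * c) ∂d.σ
          + ∫ t : ℝ, (v t - (t : ℂ) / (1 + (t : ℂ) ^ 2) * b) ∂d.σ := by
      rw [← integral_add hu.integrable hv.integrable]
      refine integral_congr_ae ?_
      filter_upwards [Lp.coeFn_add u v] with t h3
      rw [h3, Pi.add_apply]
      ring
    rw [h, hu.2, hv.2]
    ring

theorem Relation.smul (a : ℂ) (hu : d.Relation u u' c e) :
    d.Relation (a • u) (a • u') (a * c) (a * e) := by
  constructor
  · filter_upwards [hu.1, Lp.coeFn_smul a u, Lp.coeFn_smul a u'] with t h1 h2 h3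
    rw [h2, h3, Pi.smul_apply, Pi.smul_apply, ← h1, smul_eq_mul, smul_eq_mul]
    ring
  · have h : ∫ t : ℝ, ((a • u : d.L2) t - (t : ℂ) / (1 + (t : ℂ) ^ 2) * (a * c)) ∂d.σ
        = a * ∫ t : ℝ, (u t - (t : ℂ) / (1 + (t : ℂ) ^ 2) * c) ∂d.σ := by
      rw [← integral_const_mul]
      refine integral_congr_ae ?_
      filter_upwards [Lp.coeFn_smul a u] with t h3
      rw [h3, Pi.smul_apply, smul_eq_mul]
      ring
    rw [h, hu.2]
    ring

/-- Both sides are the integral of `u * conj b - c * conj v`; the terms with `h` and `t / (1 + t²)`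
cancel because these are real. -/
theorem Relation.green (hu : d.Relation u u' c e) (hv : d.Relation v v' b k) :
    inner ℂ v u' - inner ℂ v' u = e * conj b - c * conj k := by
  have hconj : ∫ t : ℝ, conj (v t - (t : ℂ) / (1 + (t : ℂ) ^ 2) * b) ∂d.σ
      = conj (∫ t : ℝ, (v t - (t : ℂ) / (1 + (t : ℂ) ^ 2) * b) ∂d.σ) := integral_conj
  have hv'' : Integrable (fun t : ℝ => conj (v t - (t : ℂ) / (1 + (t : ℂ) ^ 2) * b)) d.σ :=
    (RCLike.conjCLE (K := ℂ)).toContinuousLinearMap.integrable_comp hv.integrable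
  rw [hu.2, hv.2, map_add, map_mul, Complex.conj_ofReal, ← hconj, L2.inner_def, L2.inner_def,
    ← integral_sub (L2.integrable_inner _ _) (L2.integrable_inner _ _)]
  have h : ∀ X Y : ℂ, (d.h * c + X) * conj b - c * (d.h * conj b + Y) = X * conj b - c * Y :=
    fun X Y => by ring
  rw [h, ← integral_mul_const, ← integral_const_mul, ← integral_sub
    (hu.integrable.mul_const _) (hv''.const_mul _)]
  refine integral_congr_ae ?_
  filter_upwards [hu.1, hv.1] with t h1 h2
  simp only [RCLike.inner_apply, ← h1, ← h2, map_sub, map_mul, map_div₀, map_add, map_one, map_pow,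
    Complex.conj_ofReal]
  ring

theorem memLp_inv_sub (d : NevanlinnaData) {z : ℂ} (hz : z.im ≠ 0) :
    MemLp (fun t : ℝ => ((t : ℂ) - z)⁻¹) 2 d.σ := by
  have hI : Complex.I.im ≠ 0 := by simp
  have hm := Complex.measurable_inv_ofReal_sub
  have h1 : MemLp (fun t : ℝ => ((t : ℂ) - Complex.I)⁻¹) 2 d.σ := by
    rw [memLp_two_iff_integrable_sq_norm (hm _).aestronglyMeasurable]
    refine d.integrable.congr (Filter.Eventually.of_forall fun t => ?_)
    have : ‖(t : ℂ) - Complex.I‖ ^ 2 = 1 + t ^ 2 := by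
      rw [Complex.sq_norm, Complex.normSq_apply]
      simp
      ring
    simp only [norm_inv, inv_pow, this, one_div]
  exact h1.of_le_mul (hm z).aestronglyMeasurable
    (Filter.Eventually.of_forall (Complex.norm_inv_ofReal_sub_le_mul hz hI))

theorem memLp_mul_inv_sub (w : d.L2) {z : ℂ} (hz : z.im ≠ 0) :
    MemLp (fun t : ℝ => w t * ((t : ℂ) - z)⁻¹) 2 d.σ := by
  refine (Lp.memLp w).of_le_mul (c := |z.im|⁻¹) ((Lp.aestronglyMeasurable w).mul
    (Complex.measurable_inv_ofReal_sub z).aestronglyMeasurable)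
    (Filter.Eventually.of_forall fun t => ?_)
  rw [norm_mul, mul_comm]
  gcongr
  exact Complex.norm_inv_ofReal_sub_le hz t

/-- The solution is `u = w / (t - z)`. -/
theorem exists_relation_add_smul (d : NevanlinnaData) {z : ℂ} (hz : z.im ≠ 0) (w : d.L2) :
    ∃ u e, d.Relation u (w + z • u) 0 e := by
  refine ⟨(memLp_mul_inv_sub w hz).toLp _, _, ?_, rfl⟩
  filter_upwards [(memLp_mul_inv_sub w hz).coeFn_toLp, Lp.coeFn_add w
    (z • (memLp_mul_inv_sub w hz).toLp _), Lp.coeFn_smul z ((memLp_mul_inv_sub w hz).toLp _)]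
    with t h1 h2 h3
  rw [h2, Pi.add_apply, h3, Pi.smul_apply, h1, smul_eq_mul]
  have := Complex.ofReal_sub_ne_zero hz t
  field_simp
  ring

/-- The integral part of a Nevanlinna function, `h + ∫ (1 / (t - z) - t / (1 + t²)) dσ`. -/
noncomputable def weyl (d : NevanlinnaData) (z : ℂ) : ℂ :=
  d.h + ∫ t : ℝ, (1 / ((t : ℂ) - z) - (t : ℂ) / (1 + (t : ℂ) ^ 2)) ∂d.σ

theorem conj_weyl (d : NevanlinnaData) (z : ℂ) : conj (d.weyl z) = d.weyl (conj z) := by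
  rw [weyl, weyl, map_add, Complex.conj_ofReal, ← integral_conj]
  simp

theorem symmExtend_eq {f : ℂ → ℂ} (hf : d.Represents f) {z : ℂ} (hz : z.im ≠ 0) :
    symmExtend f z = d.h₀ * z + d.weyl z := by
  rw [symmExtend]
  split_ifs with h
  · rw [hf z h, weyl, add_assoc]
  · have hz' : 0 < (conj z).im := by
      rw [Complex.conj_im]
      exact neg_pos.2 (lt_of_le_of_ne (not_lt.1 h) hz)
    rw [hf _ hz', add_assoc]
    change conj (d.h₀ * conj z + d.weyl (conj z)) = _
    rw [map_add, map_mul, Complex.conj_ofReal, Complex.conj_conj, conj_weyl, Complex.conj_conj]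

/-- The function `t ↦ 1 / (t - z)` as an element of `L²(σ)`. -/
noncomputable def kernel (d : NevanlinnaData) {z : ℂ} (hz : z.im ≠ 0) : d.L2 :=
  (d.memLp_inv_sub hz).toLp _

theorem relation_kernel (d : NevanlinnaData) {z : ℂ} (hz : z.im ≠ 0) :
    d.Relation (d.kernel hz) (z • d.kernel hz) 1 (d.weyl z) := by
  have hk := (d.memLp_inv_sub hz).coeFn_toLp
  constructor
  · filter_upwards [hk, Lp.coeFn_smul z (d.kernel hz)] with t h1 h2
    rw [h2, Pi.smul_apply, kernel, h1, smul_eq_mul]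
    have := Complex.ofReal_sub_ne_zero hz t
    field_simp
    ring
  · rw [weyl, mul_one, add_right_inj]
    refine integral_congr_ae ?_
    filter_upwards [hk] with t h1
    rw [kernel, h1, mul_one, one_div]

theorem inner_kernel (u : d.L2) {z : ℂ} (hz : z.im ≠ 0) :
    inner ℂ (d.kernel hz) u = ∫ t : ℝ, u t * ((t : ℂ) - conj z)⁻¹ ∂d.σ := by
  rw [L2.inner_def]
  refine integral_congr_ae ?_
  filter_upwards [(d.memLp_inv_sub hz).coeFn_toLp] with t h1
  rw [kernel, RCLike.inner_apply, h1, map_inv₀, map_sub, Complex.conj_ofReal]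

theorem integrable_mul_inv_sub (u : d.L2) {z : ℂ} (hz : z.im ≠ 0) :
    Integrable (fun t : ℝ => u t * ((t : ℂ) - z)⁻¹) d.σ :=
  (Lp.memLp u).integrable_mul (d.memLp_inv_sub hz)

theorem eq_zero_of_integral_mul_inv_sub (u : d.L2)
    (h : ∀ z : ℂ, z.im ≠ 0 → ∫ t : ℝ, u t * ((t : ℂ) - z)⁻¹ ∂d.σ = 0) : u = 0 :=
  Lp.ext ((ae_eq_zero_of_integral_mul_inv_eq_zero (Lp.aestronglyMeasurable u)
    (integrable_mul_inv_sub u (by simp)) h).trans (Lp.coeFn_zero ℂ 2 d.σ).symm)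

theorem isBoundaryRelation_of_eq_zero {f : ℂ → ℂ} (hf : d.Represents f) (h0 : d.h₀ = 0) :
    IsBoundaryRelation d.Relation (symmExtend f) := by
  have hw : ∀ z : ℂ, z.im ≠ 0 → symmExtend f z = d.weyl z := fun z hz => by
    rw [symmExtend_eq hf hz, h0, Complex.ofReal_zero, zero_mul, zero_add]
  have hdef : ∀ z : ℂ, ∀ hz : z.im ≠ 0,
      d.Relation (d.kernel hz) (z • d.kernel hz) 1 (symmExtend f z) := fun z hz => by
    rw [hw z hz]
    exact d.relation_kernel hz
  refine ⟨Relation.add, fun a _ _ _ _ h => h.smul a, Relation.green,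
    fun z hz => d.exists_relation_add_smul hz,
    fun z hz => ⟨_, hdef z hz⟩, fun u hu => eq_zero_of_integral_mul_inv_sub u fun z hz => ?_⟩
  have hz' : (conj z).im ≠ 0 := by simpa using hz
  have := hu _ hz' _ (hdef _ hz')
  rwa [inner_kernel, Complex.conj_conj] at this

/-- The relation in `L²(σ) ⊕ ℂ` used when `h₀ > 0`: the second component of `u` is `-h₀ c`, and
that of `u'` is subtracted from `e`. It contributes the term `h₀ z` to the Weyl function. -/
def RelationPos (d : NevanlinnaData) (hd : 0 < d.h₀)
    (u u' : WithLp 2 (d.L2 × WeightedLine d.h₀ hd)) (c e : ℂ) : Prop :=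
  d.Relation u.fst u'.fst c (e + WeightedLine.toC d.h₀ hd u'.snd) ∧
    WeightedLine.toC d.h₀ hd u.snd = -(d.h₀ : ℂ) * c

/-- The Cauchy transform of `u ∈ L²(σ)` tends to `0` along the imaginary axis. -/
theorem tendsto_integral_mul_inv_sub (u : d.L2) :
    Filter.Tendsto (fun n : ℕ => ∫ t : ℝ, u t * ((t : ℂ) - (n + 1) * Complex.I)⁻¹ ∂d.σ)
      Filter.atTop (nhds 0) := by
  rw [← integral_zero ℝ ℂ (μ := d.σ)]
  refine tendsto_integral_of_dominated_convergence
    (fun t : ℝ => ‖u t * ((t : ℂ) - Complex.I)⁻¹‖)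
    (fun n => (Lp.aestronglyMeasurable u).mul
      (Complex.measurable_inv_ofReal_sub _).aestronglyMeasurable)
    (integrable_mul_inv_sub u (by simp)).norm
    (fun n => Filter.Eventually.of_forall fun t => ?_) (Filter.Eventually.of_forall fun t => ?_)
  · rw [norm_mul, norm_mul, norm_inv, norm_inv]
    have hI := Complex.ofReal_sub_ne_zero (z := Complex.I) (by simp) t
    gcongr
    rw [← sq_le_sq₀ (norm_nonneg _) (norm_nonneg _), Complex.sq_norm, Complex.sq_norm,
      Complex.normSq_apply, Complex.normSq_apply]
    simp
    nlinarith [(Nat.cast_nonneg n : (0 : ℝ) ≤ n)]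
  · rw [← mul_zero (u t)]
    refine Filter.Tendsto.const_mul _ (tendsto_zero_iff_norm_tendsto_zero.2 ?_)
    refine squeeze_zero (fun _ => norm_nonneg _) (fun n : ℕ => ?_)
      (tendsto_one_div_add_atTop_nhds_zero_nat (𝕜 := ℝ))
    have him : (((n : ℂ) + 1) * Complex.I).im = n + 1 := by simp
    have hpos : (0 : ℝ) < n + 1 := by positivity
    have := Complex.norm_inv_ofReal_sub_le (z := ((n : ℂ) + 1) * Complex.I)
      (by rw [him]; exact hpos.ne') t
    rw [him, abs_of_pos hpos] at this
    rwa [one_div ((n : ℝ) + 1)]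

/-- The defect elements are `(1 / (t - z), -h₀)`. -/
theorem isBoundaryRelation_of_pos {f : ℂ → ℂ} (hf : d.Represents f) (hd : 0 < d.h₀) :
    IsBoundaryRelation (d.RelationPos hd) (symmExtend f) := by
  have hne : (d.h₀ : ℂ) ≠ 0 := by exact_mod_cast hd.ne'
  have hdef : ∀ z : ℂ, ∀ hz : z.im ≠ 0, ∀ γ : WithLp 2 (d.L2 × WeightedLine d.h₀ hd),
      γ = WithLp.toLp 2 (d.kernel hz, (WeightedLine.toC d.h₀ hd).symm (-(d.h₀ : ℂ))) →
      d.RelationPos hd γ (z • γ) 1 (symmExtend f z) := by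
    rintro z hz γ rfl
    refine ⟨?_, by simp⟩
    change d.Relation (d.kernel hz) (z • d.kernel hz) 1 (symmExtend f z
      + WeightedLine.toC d.h₀ hd (z • (WeightedLine.toC d.h₀ hd).symm (-(d.h₀ : ℂ))))
    rw [symmExtend_eq hf hz, map_smul, LinearEquiv.apply_symm_apply, smul_eq_mul]
    convert d.relation_kernel hz using 1
    ring
  refine ⟨?_, ?_, ?_, ?_, fun z hz => ⟨_, hdef z hz _ rfl⟩, ?_⟩
  · rintro u u' c e v v' b k ⟨h1, h2⟩ ⟨h3, h4⟩
    refine ⟨?_, ?_⟩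
    · rw [WithLp.add_fst, WithLp.add_fst, WithLp.add_snd, map_add]
      convert h1.add h3 using 1
      ring
    · rw [WithLp.add_snd, map_add, h2, h4]
      ring
  · rintro a u u' c e ⟨h1, h2⟩
    refine ⟨?_, ?_⟩
    · rw [WithLp.smul_fst, WithLp.smul_fst, WithLp.smul_snd, map_smul, smul_eq_mul]
      convert h1.smul a using 1
      ring
    · rw [WithLp.smul_snd, map_smul, h2, smul_eq_mul]
      ring
  · rintro u u' c e v v' b k ⟨h1, h2⟩ ⟨h3, h4⟩
    have h := h1.green h3
    rw [WithLp.prod_inner_apply, WithLp.prod_inner_apply]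
    change inner ℂ v.fst u'.fst + inner ℂ v.snd u'.snd
      - (inner ℂ v'.fst u.fst + inner ℂ v'.snd u.snd) = _
    rw [WeightedLine.inner_def, WeightedLine.inner_def, h2, h4]
    simp only [map_add, map_mul, map_neg, Complex.conj_ofReal] at h ⊢
    have e1 : ∀ X Y : ℂ, X * (-(d.h₀ : ℂ) * Y) / d.h₀ = -(X * Y) := fun X Y => by field_simp
    have e2 : ∀ X Y : ℂ, (-(d.h₀ : ℂ) * X) * Y / d.h₀ = -(X * Y) := fun X Y => by field_simp
    rw [e1, e2]
    linear_combination h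
  · intro z hz w
    obtain ⟨u, e, hu⟩ := d.exists_relation_add_smul hz w.fst
    refine ⟨WithLp.toLp 2 (u, 0), e - WeightedLine.toC d.h₀ hd w.snd, ?_, by simp⟩
    change d.Relation u (w.fst + z • u) 0 (e - WeightedLine.toC d.h₀ hd w.snd
      + WeightedLine.toC d.h₀ hd (w.snd + z • (0 : WeightedLine d.h₀ hd)))
    rwa [smul_zero, add_zero, sub_add_cancel]
  -- Orthogonality to the defect elements says that the Cauchy transform of `u₁` is the constant `u₂`;
  -- its limit at `i ∞` shows that this constant is `0`.
  · intro u hu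
    have hint : ∀ z : ℂ, z.im ≠ 0 →
        ∫ t : ℝ, u.fst t * ((t : ℂ) - z)⁻¹ ∂d.σ = WeightedLine.toC d.h₀ hd u.snd := by
      intro z hz
      have hz' : (conj z).im ≠ 0 := by simpa using hz
      have h := hu _ hz' _ (hdef _ hz' _ rfl)
      rw [WithLp.prod_inner_apply] at h
      change inner ℂ (d.kernel hz') u.fst
        + inner ℂ ((WeightedLine.toC d.h₀ hd).symm (-(d.h₀ : ℂ))) u.snd = 0 at h
      rw [inner_kernel, Complex.conj_conj, WeightedLine.inner_def, LinearEquiv.apply_symm_apply,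
        map_neg, Complex.conj_ofReal, mul_neg, neg_div, mul_div_cancel_right₀ _ hne] at h
      linear_combination h
    have h2 : WeightedLine.toC d.h₀ hd u.snd = 0 := by
      refine tendsto_nhds_unique ?_ (tendsto_integral_mul_inv_sub u.fst)
      refine tendsto_const_nhds.congr fun n => (hint _ ?_).symm
      have : (0 : ℝ) < n + 1 := by positivity
      simpa using this.ne'
    have h1 : u.fst = 0 := eq_zero_of_integral_mul_inv_sub _ fun z hz => by rw [hint z hz, h2]
    exact (WithLp.ext_iff 2).2 (Prod.ext h1 ((LinearEquiv.map_eq_zero_iff _).1 h2))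

end NevanlinnaData

/-! ### The model operators as couplings -/

section ModelCoupling

variable {H : Type*} [NormedAddCommGroup H] [InnerProductSpace ℂ H] [CompleteSpace H]
  {A : H →ₗ.[ℂ] H} (Γ : BoundaryTriplet A) (d : NevanlinnaData)

theorem isCoupling_modelZero : IsCoupling Γ d.Relation (modelZero Γ d) := by
  intro x y
  constructor
  · rintro ⟨h, rfl⟩
    have hx : x.fst ∈ A†.domain := (pairOfZero Γ d ⟨x, h⟩).1.1.2
    refine ⟨hx, rfl, NevanlinnaData.relation_iff.2 ⟨(pairOfZero Γ d ⟨x, h⟩).2, rfl, ?_⟩⟩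
    have h0 : pairFunctional Γ d (pairOfZero Γ d ⟨x, h⟩) = 0 := by
      have h' := h
      obtain ⟨p, hp, hp', hp''⟩ := h'
      have hpx : pairOfZero Γ d ⟨x, h⟩ = p :=
        Subtype.ext (Prod.ext (Subtype.ext hp.symm) hp'.symm)
      rw [hpx, hp'']
    change Γ.Γ₁ ⟨x.fst, hx⟩ + d.h * Γ.Γ₀ ⟨x.fst, hx⟩ + d.intMap _ = 0 at h0
    refine neg_eq_of_add_eq_zero_right ?_
    rw [← add_assoc]
    exact h0
  · rintro ⟨hx, hA, hS⟩
    obtain ⟨hm, hmul, he⟩ := NevanlinnaData.relation_iff.1 hS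
    have h : x ∈ domainZero Γ d := by
      refine ⟨⟨(⟨x.fst, hx⟩, x.snd), hm⟩, rfl, rfl, ?_⟩
      change Γ.Γ₁ ⟨x.fst, hx⟩ + d.h * Γ.Γ₀ ⟨x.fst, hx⟩
        + d.intMap ⟨(x.snd, Γ.Γ₀ ⟨x.fst, hx⟩), hm⟩ = 0
      linear_combination -he
    exact ⟨h, (WithLp.ext_iff 2).2 (Prod.ext hA hmul)⟩

theorem isCoupling_modelPos (hd : 0 < d.h₀) :
    IsCoupling Γ (d.RelationPos hd) (modelPos Γ d hd) := by
  intro x y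
  constructor
  · rintro ⟨h, rfl⟩
    have hx : x.fst ∈ A†.domain := (pairOfPos Γ d hd ⟨x, h⟩).1.1.2
    refine ⟨hx, rfl, NevanlinnaData.relation_iff.2 ⟨(pairOfPos Γ d hd ⟨x, h⟩).2, rfl, ?_⟩, ?_⟩
    · change -Γ.Γ₁ ⟨x.fst, hx⟩ + (Γ.Γ₁ ⟨x.fst, hx⟩ + d.h * Γ.Γ₀ ⟨x.fst, hx⟩ + d.intMap _)
        = d.h * Γ.Γ₀ ⟨x.fst, hx⟩ + d.intMap _
      rw [add_assoc, neg_add_cancel_left]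
      rfl
    · obtain ⟨p, hp, -, hp''⟩ := h
      rw [hp'']
      exact congrArg (fun a => -(d.h₀ : ℂ) * Γ.Γ₀ a) (Subtype.ext hp)
  · rintro ⟨hx, hA, hS, hS'⟩
    obtain ⟨hm, hmul, he⟩ := NevanlinnaData.relation_iff.1 hS
    have h : x ∈ domainPos Γ d hd := ⟨⟨(⟨x.fst, hx⟩, x.snd.fst), hm⟩, rfl, rfl, hS'⟩
    have hval : Γ.Γ₁ ⟨x.fst, hx⟩ + d.h * Γ.Γ₀ ⟨x.fst, hx⟩
        + d.intMap ⟨(x.snd.fst, Γ.Γ₀ ⟨x.fst, hx⟩), hm⟩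
        = WeightedLine.toC d.h₀ hd y.snd.snd := by
      linear_combination -he
    exact ⟨h, (WithLp.ext_iff 2).2 (Prod.ext hA ((WithLp.ext_iff 2).2 (Prod.ext hmul
      ((LinearEquiv.symm_apply_eq _).2 hval))))⟩

end ModelCoupling

/-! ### The Herglotz representation in the unit disc -/

section Herglotz

/-- The Borel σ-algebra of the circle. -/
noncomputable instance Circle.instMeasurableSpace : MeasurableSpace Circle := borel Circle

instance Circle.instBorelSpace : BorelSpace Circle := ⟨rfl⟩

/-- The Schwarz integral formula: both sides are holomorphic with the same real part, and they
agree at the centre. -/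
theorem DiffContOnCl.eq_circleAverage_herglotzRieszKernel {g : ℂ → ℂ} {r : ℝ}
    (hg : DiffContOnCl ℂ g (Metric.ball 0 r)) {w : ℂ} (hw : w ∈ Metric.ball 0 r) :
    g w = (g 0).im * Complex.I + Real.circleAverage
      (fun ζ => herglotzRieszKernel 0 w ζ • (((g ζ).re : ℝ) : ℂ)) 0 r := by
  have hr : 0 < r := Metric.pos_of_mem_ball hw
  have hcont : ContinuousOn g (Metric.sphere 0 |r|) := by
    rw [abs_of_pos hr]
    refine hg.continuousOn.mono ?_
    rw [closure_ball _ hr.ne']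
    exact Metric.sphere_subset_closedBall
  have hci : CircleIntegrable (fun ζ => (g ζ).re) 0 r :=
    (Complex.continuous_re.comp_continuousOn hcont).circleIntegrable'
  have hci' : CircleIntegrable (fun ζ => (((g ζ).re : ℝ) : ℂ)) 0 r :=
    (Complex.continuous_ofReal.comp_continuousOn
      (Complex.continuous_re.comp_continuousOn hcont)).circleIntegrable'
  set G : ℂ → ℂ := fun w => Real.circleAverage
    (fun ζ => herglotzRieszKernel 0 w ζ • (((g ζ).re : ℝ) : ℂ)) 0 r with hG
  -- Poisson's formula gives the real part of the Schwarz integral.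
  have hGre : ∀ w ∈ Metric.ball (0 : ℂ) r, (G w).re = (g w).re := by
    intro w hw
    have h1 := re_circleAverage_herglotzRieszKernel_smul hci hw
    have h2 := hg.circleAverage_re_herglotzRieszKernel_smul hw
    have hint : CircleIntegrable ((Complex.re ∘ herglotzRieszKernel 0 w) • g) 0 r := by
      refine ContinuousOn.circleIntegrable' ?_
      exact (Complex.continuous_re.comp_continuousOn
        (continuousOn_herglotzRieszKernel_sphere hw)).smul hcont
    have h3 := Complex.reCLM.circleAverage_comp_comm hint
    rw [h2] at h3
    rw [hG, h1]
    refine Eq.trans ?_ h3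
    congr 1
    ext ζ
    simp
  have hana : AnalyticOnNhd ℂ (fun w => g w - G w) (Metric.ball 0 r) :=
    (hg.differentiableOn.sub
      (differentiableOn_circleAverage_herglotzRieszKernel_smul hci')).analyticOnNhd
      Metric.isOpen_ball
  obtain ⟨c, hc⟩ := hana.eq_const_of_re_eq_const (c₀ := 0)
    (fun w hw => by simp [hGre w hw]) Metric.isOpen_ball
    (Metric.isConnected_ball hr)
  have h0 : (0 : ℂ) ∈ Metric.ball 0 r := Metric.mem_ball_self hr
  have hG0 : (G 0).im = 0 := by
    have : G 0 = ((Real.circleAverage (fun ζ => (g ζ).re) 0 r : ℝ) : ℂ) := by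
      have h4 := Complex.ofRealCLM.circleAverage_comp_comm hci
      refine Eq.trans (Real.circleAverage_congr_sphere fun ζ hζ => ?_) h4
      have hζ0 : ζ ≠ 0 := by
        rintro rfl
        rw [mem_sphere_iff_norm, sub_zero, norm_zero] at hζ
        exact hr.ne (hζ.trans (abs_of_pos hr))
      simp [herglotzRieszKernel_def, div_self hζ0]
    rw [this, Complex.ofReal_im]
  have hc0 : c = (g 0).im * Complex.I := by
    rw [← hc _ h0]
    apply Complex.ext
    · simp [hGre 0 h0]
    · simp [hG0]
  rw [← hc0, ← hc _ hw, sub_add_cancel]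

/-- The measure on the unit circle with density `u (r ζ)` with respect to normalized arc length. -/
noncomputable def circleDensity (u : ℂ → ℝ) (r : ℝ) : Measure Circle :=
  ((volume.restrict (Set.Ioc 0 (2 * Real.pi))).withDensity
    fun θ => ENNReal.ofReal ((2 * Real.pi)⁻¹ * u (circleMap 0 r θ))).map Circle.exp

theorem integral_circleDensity {u : ℂ → ℝ} {r : ℝ} (hu : Continuous fun θ => u (circleMap 0 r θ))
    (hu0 : ∀ θ, 0 ≤ u (circleMap 0 r θ)) {F : Circle → ℂ} (hF : Continuous F) :
    ∫ ζ, F ζ ∂circleDensity u r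
      = (2 * Real.pi)⁻¹ • ∫ θ in (0)..(2 * Real.pi), F (Circle.exp θ) * u (circleMap 0 r θ) := by
  rw [circleDensity, integral_map Circle.exp.continuous.measurable.aemeasurable
    hF.aestronglyMeasurable, integral_withDensity_eq_integral_toReal_smul
    (hu.const_mul _).measurable.ennreal_ofReal
    (Filter.Eventually.of_forall fun _ => ENNReal.ofReal_lt_top),
    intervalIntegral.integral_of_le Real.two_pi_pos.le, ← integral_smul]
  refine integral_congr_ae (Filter.Eventually.of_forall fun θ => ?_)
  have : 0 ≤ (2 * Real.pi)⁻¹ * u (circleMap 0 r θ) :=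
    mul_nonneg (inv_nonneg.2 Real.two_pi_pos.le) (hu0 θ)
  simp only [ENNReal.toReal_ofReal this, Complex.real_smul]
  push_cast
  ring

theorem isFiniteMeasure_circleDensity {u : ℂ → ℝ} {r : ℝ}
    (hu : Continuous fun θ => u (circleMap 0 r θ)) : IsFiniteMeasure (circleDensity u r) := by
  have : IsFiniteMeasure ((volume.restrict (Set.Ioc 0 (2 * Real.pi))).withDensity
      fun θ => ENNReal.ofReal ((2 * Real.pi)⁻¹ * u (circleMap 0 r θ))) := by
    refine isFiniteMeasure_withDensity_ofReal ?_
    exact ((hu.const_mul _).integrableOn_Ioc (a := 0) (b := 2 * Real.pi)).2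
  exact Measure.isFiniteMeasure_map _ _

theorem Circle.sub_ne_zero_of_mem_ball {w : ℂ} (hw : w ∈ Metric.ball (0 : ℂ) 1) (ζ : Circle) :
    (ζ : ℂ) - w ≠ 0 := by
  intro h
  rw [sub_eq_zero] at h
  rw [← h, mem_ball_zero_iff, Circle.norm_coe] at hw
  exact lt_irrefl _ hw

theorem Circle.continuous_herglotzKernel {w : ℂ} (hw : w ∈ Metric.ball (0 : ℂ) 1) :
    Continuous fun ζ : Circle => ((ζ : ℂ) + w) / (ζ - w) :=
  (by fun_prop : Continuous fun ζ : Circle => (ζ : ℂ) + w).div (by fun_prop)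
    (Circle.sub_ne_zero_of_mem_ball hw)

/-- The Schwarz formula on the circle of radius `r`, rescaled to the unit circle. -/
theorem exists_finiteMeasure_herglotz_radius {g : ℂ → ℂ}
    (hg : DifferentiableOn ℂ g (Metric.ball 0 1)) (hre : ∀ w ∈ Metric.ball (0 : ℂ) 1, 0 ≤ (g w).re)
    {r : ℝ} (hr0 : 0 < r) (hr1 : r < 1) :
    ∃ μ : FiniteMeasure Circle, ∀ w ∈ Metric.ball (0 : ℂ) 1,
      g (r * w) = (g 0).im * Complex.I
        + ∫ ζ : Circle, ((ζ : ℂ) + w) / (ζ - w) ∂(μ : Measure Circle) := by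
  have hmem : ∀ θ, circleMap 0 r θ ∈ Metric.ball (0 : ℂ) 1 := fun θ => by
    rw [mem_ball_zero_iff, norm_circleMap_zero, abs_of_pos hr0]
    exact hr1
  have hcont : Continuous fun θ => (g (circleMap 0 r θ)).re := Complex.continuous_re.comp
    (hg.continuousOn.comp_continuous (continuous_circleMap _ _) hmem)
  refine ⟨⟨circleDensity (fun ζ => (g ζ).re) r, isFiniteMeasure_circleDensity hcont⟩,
    fun w hw => ?_⟩
  have hcl : DiffContOnCl ℂ g (Metric.ball 0 r) := by
    refine DifferentiableOn.diffContOnCl (hg.mono ?_)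
    rw [closure_ball _ hr0.ne']
    exact Metric.closedBall_subset_ball hr1
  have hw' : (r : ℂ) * w ∈ Metric.ball (0 : ℂ) r := by
    rw [mem_ball_zero_iff] at hw ⊢
    rw [norm_mul, Complex.norm_real, Real.norm_of_nonneg hr0.le]
    exact mul_lt_of_lt_one_right hr0 hw
  have hrn : (r : ℂ) ≠ 0 := by exact_mod_cast hr0.ne'
  rw [hcl.eq_circleAverage_herglotzRieszKernel hw', add_right_inj, FiniteMeasure.toMeasure_mk,
    integral_circleDensity hcont (fun θ => hre _ (hmem θ)) (Circle.continuous_herglotzKernel hw),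
    Real.circleAverage_def]
  refine congrArg _ (intervalIntegral.integral_congr fun θ _ => ?_)
  rw [smul_eq_mul, herglotzRieszKernel_def, sub_zero, sub_zero, Circle.coe_exp,
    circleMap, zero_add, ← mul_add, ← mul_sub, mul_div_mul_left _ _ hrn]

/-- **Herglotz representation**: a holomorphic function on the unit disc with nonnegative real part
is, up to an imaginary constant, the Herglotz transform of a finite measure on the circle. The
measure is a weak limit of the densities `Re g (r ζ)` as `r → 1`, all of mass `Re (g 0)`. -/
theorem exists_finiteMeasure_herglotz {g : ℂ → ℂ}
    (hg : DifferentiableOn ℂ g (Metric.ball 0 1)) (hre : ∀ w ∈ Metric.ball (0 : ℂ) 1, 0 ≤ (g w).re) :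
    ∃ μ : FiniteMeasure Circle, ∀ w ∈ Metric.ball (0 : ℂ) 1,
      g w = (g 0).im * Complex.I
        + ∫ ζ : Circle, ((ζ : ℂ) + w) / (ζ - w) ∂(μ : Measure Circle) := by
  set r : ℕ → ℝ := fun n => 1 - 1 / ((n : ℝ) + 1 + 1) with hr
  have hr0 : ∀ n, 0 < r n := fun n => by
    rw [hr, sub_pos, div_lt_one (by positivity)]
    have : (0 : ℝ) < n + 1 := by positivity
    linarith
  have hr1 : ∀ n, r n < 1 := fun n => sub_lt_self _ (by positivity)
  have hrlim : Filter.Tendsto r Filter.atTop (nhds 1) := by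
    have := (tendsto_one_div_add_atTop_nhds_zero_nat (𝕜 := ℝ)).comp (Filter.tendsto_add_atTop_nat 1)
    simpa [hr, Function.comp_def] using this.const_sub 1
  choose μs hrep using fun n => exists_finiteMeasure_herglotz_radius hg hre (hr0 n) (hr1 n)
  have hmass : ∀ n, ((μs n).mass : ℝ) = (g 0).re := by
    intro n
    have hone : ∫ ζ : Circle, ((ζ : ℂ) + 0) / (ζ - 0) ∂(μs n : Measure Circle)
        = (((μs n).mass : ℝ) : ℂ) := by
      have h1 : ∀ ζ : Circle, ((ζ : ℂ) + 0) / (ζ - 0) = 1 := fun ζ => by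
        rw [add_zero, sub_zero, div_self ζ.coe_ne_zero]
      simp_rw [h1]
      rw [integral_const, Complex.real_smul, mul_one]
      rfl
    have h := hrep n 0 (Metric.mem_ball_self one_pos)
    rw [mul_zero, hone] at h
    have h' := congrArg Complex.re h
    rw [Complex.add_re, Complex.ofReal_re, Complex.re_ofReal_mul, Complex.I_re, mul_zero,
      zero_add] at h'
    exact h'.symm
  -- The masses are equal, so the sequence lies in a compact set; an ultrafilter selects a limit.
  have hcomp := isCompact_setOfPred_finiteMeasure_le_of_compactSpace Circle (g 0).re.toNNReal
  obtain ⟨μ, -, hμ⟩ := hcomp.ultrafilter_le_nhds ((Filter.hyperfilter ℕ).map μs) (by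
    rw [Ultrafilter.coe_map, Filter.le_principal_iff]
    refine Filter.mem_map.2 (Filter.univ_mem' fun n => ?_)
    change (μs n).mass ≤ (g 0).re.toNNReal
    rw [← hmass n, Real.toNNReal_coe])
  have hlim : Filter.Tendsto μs (Filter.hyperfilter ℕ) (nhds μ) := hμ
  rw [FiniteMeasure.tendsto_iff_forall_integral_rclike_tendsto ℂ] at hlim
  refine ⟨μ, fun w hw => ?_⟩
  have h1 := hlim (BoundedContinuousFunction.mkOfCompact
    ⟨_, Circle.continuous_herglotzKernel hw⟩)
  have h2 : Filter.Tendsto (fun n => g (r n * w)) (Filter.hyperfilter ℕ) (nhds (g w)) := by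
    have hc : ContinuousAt g w := (hg.differentiableAt (Metric.isOpen_ball.mem_nhds hw)).continuousAt
    refine Filter.Tendsto.comp hc (Filter.Tendsto.mono_left ?_ Nat.hyperfilter_le_atTop)
    have := ((Complex.continuous_ofReal.tendsto 1).comp hrlim).mul_const w
    simpa using this
  refine tendsto_nhds_unique h2 ?_
  simp_rw [hrep _ w hw]
  exact h1.const_add _

end Herglotz

/-! ### The Nevanlinna representation in the upper half-plane -/

section Nevanlinna

/-- The Cayley transform `w ↦ i (1 + w) / (1 - w)` from the unit disc to the upper half-plane. -/
noncomputable def cayley (w : ℂ) : ℂ := Complex.I * ((1 + w) / (1 - w))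

theorem cayley_im (w : ℂ) : (cayley w).im = (1 - ‖w‖ ^ 2) / ‖1 - w‖ ^ 2 := by
  have h := congrFun (poissonKernel_eq_re_herglotzRieszKernel (c := 0) (w := w)) 1
  rw [Function.comp_apply, poissonKernel_def, herglotzRieszKernel_def] at h
  simp only [sub_zero, norm_one, one_pow] at h
  rw [cayley, Complex.I_mul_im, h]

theorem one_sub_ne_zero_of_mem_ball {w : ℂ} (hw : w ∈ Metric.ball (0 : ℂ) 1) : 1 - w ≠ 0 := by
  simpa using Circle.sub_ne_zero_of_mem_ball hw 1

theorem cayley_im_pos {w : ℂ} (hw : w ∈ Metric.ball (0 : ℂ) 1) : 0 < (cayley w).im := by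
  have h1 : 0 < ‖1 - w‖ := norm_pos_iff.2 (one_sub_ne_zero_of_mem_ball hw)
  have h2 : ‖w‖ ^ 2 < 1 := by
    rw [sq_lt_one_iff₀ (norm_nonneg _)]
    exact mem_ball_zero_iff.1 hw
  rw [cayley_im]
  exact div_pos (by linarith) (by positivity)

theorem differentiableOn_cayley : DifferentiableOn ℂ cayley (Metric.ball 0 1) := by
  intro w hw
  refine DifferentiableAt.differentiableWithinAt ?_
  exact (((differentiableAt_const 1).add differentiableAt_id).div
    ((differentiableAt_const 1).sub differentiableAt_id)
    (one_sub_ne_zero_of_mem_ball hw)).const_mul _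

theorem add_I_ne_zero {z : ℂ} (hz : 0 < z.im) : z + Complex.I ≠ 0 := by
  intro h
  have := congrArg Complex.im h
  simp at this
  linarith

theorem mem_ball_of_im_pos {z : ℂ} (hz : 0 < z.im) :
    (z - Complex.I) / (z + Complex.I) ∈ Metric.ball (0 : ℂ) 1 := by
  rw [mem_ball_zero_iff, norm_div, div_lt_one (norm_pos_iff.2 (add_I_ne_zero hz)),
    ← sq_lt_sq₀ (norm_nonneg _) (norm_nonneg _), Complex.sq_norm, Complex.sq_norm,
    Complex.normSq_apply, Complex.normSq_apply]
  simp
  nlinarith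

theorem cayley_sub_div_add {z : ℂ} (hz : 0 < z.im) :
    cayley ((z - Complex.I) / (z + Complex.I)) = z := by
  have h := add_I_ne_zero hz
  have h2 : 1 - (z - Complex.I) / (z + Complex.I) = 2 * Complex.I / (z + Complex.I) := by
    field_simp
    ring
  have h3 : 1 + (z - Complex.I) / (z + Complex.I) = 2 * z / (z + Complex.I) := by
    field_simp
    ring
  rw [cayley, h2, h3, div_div_div_cancel_right₀ h]
  field_simp

/-- The boundary values of the Cayley transform on the circle, which are real. At the point `1`, which
corresponds to infinity, the value is `0` by the convention for division by zero. -/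
noncomputable def Circle.toReal (ζ : Circle) : ℝ := (cayley ζ).re

theorem Circle.coe_toReal (ζ : Circle) : (ζ.toReal : ℂ) = cayley ζ := by
  refine Complex.ext (Complex.ofReal_re _) ?_
  rw [Complex.ofReal_im, cayley_im, Circle.norm_coe]
  simp

theorem Circle.measurable_toReal : Measurable Circle.toReal := by
  have h : Measurable fun ζ : Circle => (ζ : ℂ) :=
    (by fun_prop : Continuous fun ζ : Circle => (ζ : ℂ)).measurable
  unfold Circle.toReal cayley
  fun_prop

/-- The Cayley transform turns the Herglotz kernel into the Nevanlinna kernel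
`(1 + t²) (1 / (t - z) - t / (1 + t²))`. -/
theorem Circle.herglotzKernel_eq {ζ : Circle} (hζ : ζ ≠ 1) {z : ℂ} (hz : 0 < z.im) :
    Complex.I * ((ζ + (z - Complex.I) / (z + Complex.I)) / (ζ - (z - Complex.I) / (z + Complex.I)))
      = (1 + (ζ.toReal : ℂ) ^ 2)
        * (1 / ((ζ.toReal : ℂ) - z) - ζ.toReal / (1 + (ζ.toReal : ℂ) ^ 2)) := by
  have h1 : (1 : ℂ) - ζ ≠ 0 := by
    rw [sub_ne_zero]
    intro h
    exact hζ (Circle.ext (by simpa using h.symm))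
  have h2 := add_I_ne_zero hz
  set t := ζ.toReal with ht
  have h3 : (t : ℂ) - z ≠ 0 := Complex.ofReal_sub_ne_zero hz.ne' t
  have h4 : (1 : ℂ) + (t : ℂ) ^ 2 ≠ 0 := by
    have : (1 : ℝ) + t ^ 2 ≠ 0 := by positivity
    exact_mod_cast this
  have h5 : (t : ℂ) * (1 - ζ) = Complex.I * (1 + ζ) := by
    rw [ht, Circle.coe_toReal, cayley, mul_assoc, div_mul_cancel₀ _ h1]
  have h6 : (t : ℂ) + Complex.I ≠ 0 := by
    have := Complex.ofReal_sub_ne_zero (z := -Complex.I) (by simp) t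
    rwa [sub_neg_eq_add] at this
  have hζt : (ζ : ℂ) = (t - Complex.I) / (t + Complex.I) := by
    rw [eq_div_iff h6]
    linear_combination -h5
  have h7 : (ζ : ℂ) + (z - Complex.I) / (z + Complex.I)
      = 2 * (1 + t * z) / ((t + Complex.I) * (z + Complex.I)) := by
    rw [hζt]
    field_simp
    linear_combination -2 * Complex.I_sq
  have h8 : (ζ : ℂ) - (z - Complex.I) / (z + Complex.I)
      = 2 * Complex.I * (t - z) / ((t + Complex.I) * (z + Complex.I)) := by
    rw [hζt]
    field_simp
    ring
  have h9 : (1 + (t : ℂ) ^ 2) * (1 / ((t : ℂ) - z) - t / (1 + (t : ℂ) ^ 2))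
      = (1 + t * z) / (t - z) := by
    field_simp
    ring
  rw [h7, h8, h9, div_div_div_cancel_right₀ (mul_ne_zero h6 h2)]
  field_simp

/-- **Nevanlinna representation.** The mass of the Herglotz measure at `1` becomes `h₀`, and its
restriction to the rest of the circle, transported to the line, becomes `dσ / (1 + t²)`. -/
theorem IsHerglotzNevanlinna.exists_nevanlinnaData {f : ℂ → ℂ} (hf : IsHerglotzNevanlinna f) :
    ∃ d : NevanlinnaData, d.Represents f := by
  obtain ⟨μ, hμ⟩ := exists_finiteMeasure_herglotz (g := fun w => -Complex.I * f (cayley w))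
    ((hf.1.comp differentiableOn_cayley fun w hw => cayley_im_pos hw).const_mul _)
    (fun w hw => by simpa using hf.2 _ (cayley_im_pos hw))
  set c := (-Complex.I * f (cayley 0)).im with hc
  -- The point `1` is removed because `Circle.toReal` has a junk value there.
  let ν : Measure ℝ := ((μ : Measure Circle).restrict {1}ᶜ).map Circle.toReal
  have hν : IsFiniteMeasure ν := Measure.isFiniteMeasure_map _ _
  have hdens : Measurable fun t : ℝ => ENNReal.ofReal (1 + t ^ 2) := by fun_prop
  have hpos : ∀ t : ℝ, (0 : ℝ) < 1 + t ^ 2 := fun t => by positivity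
  let d : NevanlinnaData :=
    { h₀ := (μ : Measure Circle).real {1}
      h := -c
      σ := ν.withDensity fun t => ENNReal.ofReal (1 + t ^ 2)
      h₀_nonneg := measureReal_nonneg
      integrable := by
        rw [integrable_withDensity_iff_integrable_smul' hdens
          (Filter.Eventually.of_forall fun _ => ENNReal.ofReal_lt_top)]
        refine (integrable_const (1 : ℝ)).congr (Filter.Eventually.of_forall fun t => ?_)
        beta_reduce
        rw [ENNReal.toReal_ofReal (hpos t).le, smul_eq_mul, mul_one_div_cancel (hpos t).ne'] }
  refine ⟨d, fun z hz => ?_⟩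
  set w := (z - Complex.I) / (z + Complex.I) with hw
  have hwb : w ∈ Metric.ball (0 : ℂ) 1 := mem_ball_of_im_pos hz
  have hwz : cayley w = z := cayley_sub_div_add hz
  set F : Circle → ℂ := fun ζ => ((ζ : ℂ) + w) / (ζ - w) with hF
  have hFc : Continuous F := Circle.continuous_herglotzKernel hwb
  have hFi : Integrable F (μ : Measure Circle) := by
    exact hFc.integrable_of_hasCompactSupport (HasCompactSupport.of_compactSpace F)
  have hone : ∫ ζ in {1}, F ζ ∂(μ : Measure Circle) = (d.h₀ : ℂ) * (-Complex.I * z) := by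
    rw [integral_singleton, Complex.real_smul]
    have : Complex.I * F 1 = z := by
      rw [← hwz, cayley, hF]
      simp
    rw [← this]
    ring_nf
    rw [Complex.I_sq]
    ring
  have hcompl : ∫ t : ℝ, (1 / ((t : ℂ) - z) - (t : ℂ) / (1 + (t : ℂ) ^ 2)) ∂d.σ
      = Complex.I * ∫ ζ in {1}ᶜ, F ζ ∂(μ : Measure Circle) := by
    change ∫ t : ℝ, _ ∂(ν.withDensity fun t => ENNReal.ofReal (1 + t ^ 2)) = _
    rw [integral_withDensity_eq_integral_toReal_smul hdens
      (Filter.Eventually.of_forall fun _ => ENNReal.ofReal_lt_top),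
      integral_map Circle.measurable_toReal.aemeasurable
        (by fun_prop : Measurable _).aestronglyMeasurable, ← integral_const_mul]
    refine setIntegral_congr_fun (measurableSet_singleton _).compl fun ζ hζ => ?_
    rw [hF, Circle.herglotzKernel_eq hζ hz, ENNReal.toReal_ofReal (hpos _).le, Complex.real_smul]
    push_cast
    rfl
  have h := hμ w hwb
  rw [← integral_add_compl (measurableSet_singleton (1 : Circle)) hFi, hone] at h
  simp only [hwz] at h
  rw [hcompl]
  change f z = d.h₀ * z + ((-c : ℝ) : ℂ) + _
  push_cast
  linear_combination Complex.I * h + (f z - d.h₀ * z + c) * Complex.I_sq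

end Nevanlinna

theorem mainTheorem1 {H : Type*} [NormedAddCommGroup H] [InnerProductSpace ℂ H] [CompleteSpace H]
    (A : H →ₗ.[ℂ] H) (hA_dense : Dense (A.domain : Set H)) (hA_closed : A.IsClosed)
    (hA_symm : IsSymmetricOp A) (hA_def : HasDeficiencyIndices A 1 1) (Γ : BoundaryTriplet A)
    (f : ℂ → ℂ) (hf : IsHerglotzNevanlinna f) :
    (∃ d : NevanlinnaData, d.Represents f) ∧
      ∀ d : NevanlinnaData, d.Represents f →
        (d.h₀ = 0 →
          IsMinimalExtensionFor Γ f (inclFst H d.L2) (modelZero Γ d)) ∧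
        (∀ hd : 0 < d.h₀,
          IsMinimalExtensionFor Γ f (inclFst H (WithLp 2 (d.L2 × WeightedLine d.h₀ hd)))
            (modelPos Γ d hd)) :=
  ⟨hf.exists_nevanlinnaData, fun d hdf =>
    ⟨fun h0 => (isCoupling_modelZero Γ d).isMinimalExtensionFor
      (NevanlinnaData.isBoundaryRelation_of_eq_zero hdf h0) hA_dense hA_closed hA_symm,
    fun hd => (isCoupling_modelPos Γ d hd).isMinimalExtensionFor
      (NevanlinnaData.isBoundaryRelation_of_pos hdf hd) hA_dense hA_closed hA_symm⟩⟩
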